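/- **Setting.** Let $n\in\{2,3\}$ and let $\Omega\subset\mathbb R^n$ be a bounded polyhedral Lipschitz domain (open, connected, nonempty). Let $\mathcal M$ be a finite collection of closed bounded convex polyhedra (cells) with nonempty interior, with pairwise overlap of volume measure zero, and with $\overline\Omega=\bigcup_{K\in\mathcal M}K$. A side is a closed connected polyhedral subset $S$ of a hyperplane with positive $(n-1)$-dimensional surface measure such that either $S\subset K_+\cap K_-$ for two different cells $K_\pm$ (interior side) or $S\subset K_+\cap\partial\Omega$ for a cell $K_+$ (boundary side). Let $\Sigma$ be a finite collection of sides with pairwise overlap of surface measure zero and $\bigcup_{K\in\mathcal M}\partial K=\bigcup_{S\in\Sigma}S$ (hanging nodes are allowed). Fix a unit normal $\nu_S$ of every $S\in\Sigma$, the outer one on boundary sides. For an interior side, $K_+$ (resp. $K_-$) is the unique cell with $S\subset\partial K_\pm$ and outer normal $\pm\nu_S$ along $S$; the jump is $[q]_S=q|_{K_+}-q|_{K_-}$, and $[q]_S=q|_{K_+}$ on boundary sides. Put $\Sigma(K)=\{S\in\Sigma: S\subset\partial K\}$. Fix $k\ge 0$ and $\sigma>0$. Let $P_{k+1}(\mathcal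 M)$ be the space of piecewise polynomials of degree at most $k+1$ on the cells, $P_k(\Sigma(\Omega))$ the space of piecewise polynomials of degree at most $k$ on the sides that vanish on all boundary sides, and $V_h=P_{k+1}(\mathcal M)\times P_k(\Sigma(\Omega))$. Write $v_h=(v_{\mathcal M},v_\Sigma)\in V_h$, $v_K=v_{\mathcal M}|_K$, $v_S=v_\Sigma|_S$. The subscript $\mathrm{pw}$ denotes piecewise differential operators, and $a_{\mathrm{pw}}(u,v)=(\nabla_{\mathrm{pw}}u,\nabla_{\mathrm{pw}}v)_{L^2(\Omega)}$. The potential reconstruction $\mathcal R_hv_h\in P_{k+1}(\mathcal M)$ is given by $$a_{\mathrm{pw}}(\mathcal R_hv_h,\varphi)=-(v_{\mathcal M},\Delta_{\mathrm{pw}}\varphi)_{L^2(\Omega)}+\sum_{S\in\Sigma}(v_S,[\nabla_{\mathrm{pw}}\varphi]_S\cdot\nu_S)_{L^2(S)}\quad\text{for all }\varphi\in P_{k+1}(\mathcal M),$$ $$\int_K\mathcal R_hv_h\,dx=\int_Kv_K\,dx\quad\text{for all }K\in\mathcal M.$$ For $S\in\Sigma(K)$ let $\ell(S,K)=|S|\,h_K^2/|K_S|$,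 where $h_K$ is the diameter of $K$ and $K_S$ is the convex hull of $S$ and the barycenter of $K$. Let $\Pi_S^k$ be the $L^2(S)$ projection onto the polynomials of degree at most $k$ on $S$. For $u_h,v_h\in V_h$ set $$a_h(u_h,v_h)=a_{\mathrm{pw}}(\mathcal R_hu_h,\mathcal R_hv_h),\qquad b_h(u_h,v_h)=(u_{\mathcal M},v_{\mathcal M})_{L^2(\Omega)},$$ $$s_h(u_h,v_h)=\sum_{K\in\mathcal M}\Big(\sigma h_K^{-2}(u_K-\mathcal R_hu_h,v_K-\mathcal R_hv_h)_{L^2(K)}+\sigma\sum_{S\in\Sigma(K)}\ell(S,K)^{-1}\big(\Pi_S^k(u_S-\mathcal R_hu_h|_K),v_S-\mathcal R_hv_h|_K\big)_{L^2(S)}\Big).$$ **Lemma (coercivity).** The potential reconstruction $\mathcal R_hv_h$ exists and is unique for every $v_h\in V_h$, and the form $a_h+s_h$ is a scalar product on $V_h$ (bilinear, symmetric, positive definite). Consequently, the discrete eigenvalue problem $$a_h(u_h,v_h)+s_h(u_h,v_h)=\lambda_h\,b_h(u_h,v_h)\quad\text{for all }v_h\in V_h$$ has exactly $\dim P_{k+1}(\mathcal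 M)$ finite eigenvalues $\lambda_h\in\mathbb R$, counted with multiplicity (the dimension of the space of solutions $u_h\in V_h$). Likewise, with $N=\dim V_h$, exactly $\dim P_{k+1}(\mathcal M)$ of the Rayleigh–Ritz values $$\lambda_h(j)=\min_{W\subset V_h,\ \dim W=j}\ \max_{v_h\in W\setminus\{0\}}\frac{a_h(v_h,v_h)+s_h(v_h,v_h)}{b_h(v_h,v_h)}\in[0,\infty],\qquad j=1,\dots,N,$$ are finite, where the quotient is $\infty$ if $b_h(v_h,v_h)=0$. -/

import Mathlib

open MeasureTheory
open scoped ENNReal NNReal Classical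

noncomputable section

namespace HHO

/-- The Euclidean space `ℝⁿ`. -/
abbrev Space (n : ℕ) : Type := EuclideanSpace ℝ (Fin n)

variable {n : ℕ}

/-- An open bounded Lipschitz domain: open, bounded, connected (and nonempty), and near every
boundary point it is, in suitable Cartesian coordinates with `e` as the last coordinate direction,
the set of points strictly above the graph of a Lipschitz function of the remaining coordinates.
That the domain is polyhedral is a consequence of the existence of a polytopal mesh of it. -/
structure IsLipschitzDomain (Ω : Set (Space n)) : Prop where
  isOpen : IsOpen Ω
  isBounded : Bornology.IsBounded Ω
  isConnected : IsConnected Ω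
  lipschitz : ∀ x ∈ frontier Ω, ∃ e : Space n, ‖e‖ = 1 ∧ ∃ U : Set (Space n), IsOpen U ∧ x ∈ U ∧
    ∃ (L : ℝ≥0) (γ : Space n → ℝ), LipschitzWith L γ ∧
      ∀ y ∈ U, y ∈ Ω ↔ γ (y - inner ℝ e y • e) < inner ℝ e y

/-- A closed bounded convex polyhedron: the convex hull of finitely many points. -/
def IsConvexPolytope (P : Set (Space n)) : Prop :=
  ∃ t : Finset (Space n), P = convexHull ℝ (t : Set (Space n))

/-- A closed bounded, not necessarily convex, polyhedral set: a finite union of convex ones. -/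
def IsPolyhedralSet (S : Set (Space n)) : Prop :=
  ∃ F : Set (Set (Space n)), F.Finite ∧ (∀ P ∈ F, IsConvexPolytope P) ∧ S = ⋃₀ F

/-- The `(n-1)`-dimensional surface measure (the Hausdorff measure, normalized so that it is the
Lebesgue measure on hyperplanes). -/
def surfaceMeasure (n : ℕ) : Measure (Space n) := μHE[n - 1]

/-- `S` is an interior side: it lies in two different cells. -/
def IsInteriorSide (cells : Finset (Set (Space n))) (S : Set (Space n)) : Prop :=
  ∃ K₁ ∈ cells, ∃ K₂ ∈ cells, K₁ ≠ K₂ ∧ S ⊆ K₁ ∩ K₂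

/-- `S` is a boundary side: it lies in a cell and in the boundary of the domain. -/
def IsBoundarySide (Ω : Set (Space n)) (cells : Finset (Set (Space n))) (S : Set (Space n)) :
    Prop :=
  ∃ K ∈ cells, S ⊆ K ∩ frontier Ω

/-- A side: a closed connected polyhedral subset of a hyperplane, of positive surface measure,
that is an interior side or a boundary side. -/
structure IsSide (Ω : Set (Space n)) (cells : Finset (Set (Space n))) (S : Set (Space n)) :
    Prop where
  polyhedral : IsPolyhedralSet S
  connected : IsConnected S
  hyperplane : ∃ (ν : Space n) (c : ℝ), ν ≠ 0 ∧ ∀ x ∈ S, inner ℝ ν x = c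
  measure_pos : 0 < surfaceMeasure n S
  interior_or_boundary : IsInteriorSide cells S ∨ IsBoundarySide Ω cells S

/-- `ν` points out of the convex set `K` along `S`: the set `K` lies in the half space
`⟨ν, x - y⟩ ≤ 0` for all points `y` of `S`. -/
def IsOutward (ν : Space n) (K S : Set (Space n)) : Prop :=
  ∀ x ∈ K, ∀ y ∈ S, inner ℝ ν (x - y) ≤ 0

/-- A polytopal mesh of `Ω` with its sides and with a unit normal vector fixed for every side.
Hanging nodes are allowed. -/
structure PolytopalMesh (Ω : Set (Space n)) where
  /-- the cells -/
  cells : Finset (Set (Space n))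
  /-- the sides -/
  sides : Finset (Set (Space n))
  /-- the normal vector `ν_S` of the side `S` -/
  normal : Set (Space n) → Space n
  cell_polytope : ∀ K ∈ cells, IsConvexPolytope K
  cell_interior : ∀ K ∈ cells, (interior K).Nonempty
  cell_overlap : ∀ K₁ ∈ cells, ∀ K₂ ∈ cells, K₁ ≠ K₂ → volume (K₁ ∩ K₂) = 0
  cell_cover : closure Ω = ⋃ K ∈ cells, K
  side_isSide : ∀ S ∈ sides, IsSide Ω cells S
  side_overlap : ∀ S₁ ∈ sides, ∀ S₂ ∈ sides, S₁ ≠ S₂ → surfaceMeasure n (S₁ ∩ S₂) = 0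
  side_cover : (⋃ K ∈ cells, frontier K) = ⋃ S ∈ sides, S
  normal_unit : ∀ S ∈ sides, ‖normal S‖ = 1
  normal_orthogonal : ∀ S ∈ sides, ∀ x ∈ S, ∀ y ∈ S, inner ℝ (normal S) (x - y) = 0
  /-- on the boundary the normal is the outer one -/
  normal_boundary : ∀ S ∈ sides, IsBoundarySide Ω cells S →
    ∀ K ∈ cells, S ⊆ K → IsOutward (normal S) K S

/-- Polynomials in `n` variables of total degree at most `m`. -/
abbrev Poly (n m : ℕ) : Submodule ℝ (MvPolynomial (Fin n) ℝ) :=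
  MvPolynomial.restrictTotalDegree (Fin n) ℝ m

/-- The value of a polynomial at a point. -/
def polyEval (p : MvPolynomial (Fin n) ℝ) (x : Space n) : ℝ :=
  MvPolynomial.eval (fun i => x i) p

/-- The gradient of a polynomial at a point. -/
def polyGrad (p : MvPolynomial (Fin n) ℝ) (x : Space n) : Space n :=
  WithLp.toLp 2 fun i => polyEval (MvPolynomial.pderiv i p) x

/-- The Laplacian of a polynomial. -/
def polyLaplacian (p : MvPolynomial (Fin n) ℝ) : MvPolynomial (Fin n) ℝ :=
  ∑ i, MvPolynomial.pderiv i (MvPolynomial.pderiv i p)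

/-- Restriction of a polynomial to a function on the set `S`, as a linear map. -/
def polyRestrict (S : Set (Space n)) : MvPolynomial (Fin n) ℝ →ₗ[ℝ] (S → ℝ) where
  toFun p := fun x => polyEval p x.1
  map_add' p q := by funext x; simp [polyEval]
  map_smul' c p := by funext x; simp [polyEval]

/-- `P_m(S)` for a side `S`: the functions on `S` that are restrictions of polynomials of degree at
most `m`. (Different polynomials may have the same restriction, as `S` lies in a hyperplane.) -/
def sidePoly (m : ℕ) (S : Set (Space n)) : Submodule ℝ (S → ℝ) :=
  (Poly n m).map (polyRestrict S)

/-- The scalar product of `L²(S)` with respect to the surface measure. -/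
def sideInner {S : Set (Space n)} (f g : S → ℝ) : ℝ :=
  ∫ x : S, f x * g x ∂((surfaceMeasure n).comap Subtype.val)

/-- The scalar product of `L²(K)` of two functions given on the whole space. -/
def cellInner (K : Set (Space n)) (f g : Space n → ℝ) : ℝ :=
  ∫ x in K, f x * g x

/-- The `L²(S)` projection of `f` onto `P_m(S)`. -/
def sideProj (m : ℕ) {S : Set (Space n)} (f : S → ℝ) : S → ℝ :=
  Classical.epsilon fun p => p ∈ sidePoly m S ∧ ∀ q ∈ sidePoly m S, sideInner p q = sideInner f q

/-- The weight `ℓ(S,K) = |S| h_K² / |K_S|`, where `K_S` is the convex hull of `S` and of the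
midpoint (the barycenter) `x_K` of `K`. -/
def weight (S K : Set (Space n)) : ℝ :=
  (surfaceMeasure n).real S * Metric.diam K ^ 2 /
    volume.real (convexHull ℝ (insert (⨍ x in K, x) S))

namespace PolytopalMesh

variable {Ω : Set (Space n)} (M : PolytopalMesh Ω)

/-- The space `P_m(𝓜)` of piecewise polynomials of degree at most `m`. A polynomial on a cell is
recorded as a polynomial in `n` variables, which it determines, since cells have interior points. -/
abbrev CellSpace (m : ℕ) : Type := (K : M.cells) → Poly n m

/-- The space `P_m(Σ(Ω))` of piecewise polynomials on the sides that vanish on boundary sides. -/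
def sideSpace (m : ℕ) : Submodule ℝ ((S : M.sides) → sidePoly m S.1) where
  carrier := {v | ∀ S : M.sides, IsBoundarySide Ω M.cells S.1 → v S = 0}
  zero_mem' := fun _ _ => rfl
  add_mem' := fun hu hv S hS => by simp [hu S hS, hv S hS]
  smul_mem' := fun c v hv S hS => by simp [hv S hS]

/-- The discrete ansatz space `V_h = P_{k+1}(𝓜) × P_k(Σ(Ω))`. -/
abbrev Vh (k : ℕ) : Type := M.CellSpace (k + 1) × M.sideSpace k

/-- `a_pw(u, v) = (∇_pw u, ∇_pw v)`. -/
def aPw {m : ℕ} (u v : M.CellSpace m) : ℝ :=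
  ∑ K : M.cells, ∫ x in K.1, inner ℝ (polyGrad (u K).1 x) (polyGrad (v K).1 x)

/-- `[∇_pw φ]_S · ν_S`, where the jump is the value from the cell `K₊` minus the value from the
cell `K₋`. Each of the two sums has at most one term; on boundary sides there is no cell `K₋`. -/
def normalJump {m : ℕ} (φ : M.CellSpace m) (S : M.sides) (x : Space n) : ℝ :=
  (∑ K : M.cells with S.1 ⊆ frontier K.1 ∧ IsOutward (M.normal S.1) K.1 S.1,
      inner ℝ (polyGrad (φ K).1 x) (M.normal S.1)) -
    ∑ K : M.cells with S.1 ⊆ frontier K.1 ∧ IsOutward (-M.normal S.1) K.1 S.1,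
      inner ℝ (polyGrad (φ K).1 x) (M.normal S.1)

/-- `r ∈ P_{k+1}(𝓜)` satisfies the defining equations of the potential reconstruction of `v`. -/
def IsReconstruction {k : ℕ} (v : M.Vh k) (r : M.CellSpace (k + 1)) : Prop :=
  (∀ φ : M.CellSpace (k + 1),
    M.aPw r φ =
      -(∑ K : M.cells, cellInner K.1 (polyEval (v.1 K).1) (polyEval (polyLaplacian (φ K).1))) +
        ∑ S : M.sides, sideInner (v.2.1 S).1 (fun x => M.normalJump φ S x.1)) ∧
  ∀ K : M.cells, ∫ x in K.1, polyEval (r K).1 x = ∫ x in K.1, polyEval (v.1 K).1 x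

/-- The potential reconstruction `𝓡_h v`. -/
def recon {k : ℕ} (v : M.Vh k) : M.CellSpace (k + 1) :=
  Classical.epsilon (M.IsReconstruction v)

/-- `v_K - 𝓡_h v` on the cell `K`. -/
def cellDefect {k : ℕ} (v : M.Vh k) (K : M.cells) (x : Space n) : ℝ :=
  polyEval (v.1 K).1 x - polyEval (M.recon v K).1 x

/-- `v_S - (𝓡_h v)|_K` on the side `S` of the cell `K`. -/
def sideDefect {k : ℕ} (v : M.Vh k) (K : M.cells) (S : M.sides) (x : S.1) : ℝ :=
  (v.2.1 S).1 x - polyEval (M.recon v K).1 x.1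

/-- The local stabilization `s_K(u, v)` with parameter `σ`. The sides of `K` are the sides contained
in the boundary of `K`. -/
def stabCell (σ : ℝ) {k : ℕ} (K : M.cells) (u v : M.Vh k) : ℝ :=
  σ * (Metric.diam K.1 ^ 2)⁻¹ * cellInner K.1 (M.cellDefect u K) (M.cellDefect v K) +
    σ * ∑ S : M.sides with S.1 ⊆ frontier K.1,
      (weight S.1 K.1)⁻¹ * sideInner (sideProj k (M.sideDefect u K S)) (M.sideDefect v K S)

/-- The stabilization `s_h(u, v)`. -/
def stab (σ : ℝ) {k : ℕ} (u v : M.Vh k) : ℝ := ∑ K : M.cells, M.stabCell σ K u v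

/-- `a_h(u, v) = a_pw(𝓡_h u, 𝓡_h v)`. -/
def aForm {k : ℕ} (u v : M.Vh k) : ℝ := M.aPw (M.recon u) (M.recon v)

/-- `b_h(u, v) = (u_𝓜, v_𝓜)`. -/
def bForm {k : ℕ} (u v : M.Vh k) : ℝ :=
  ∑ K : M.cells, cellInner K.1 (polyEval (u.1 K).1) (polyEval (v.1 K).1)

/-- The solutions `u ∈ V_h` (including `0`) of the discrete eigenvalue problem
`a_h(u, v) + s_h(u, v) = lam * b_h(u, v)` for all `v ∈ V_h`. -/
def eigenvectors (σ : ℝ) (k : ℕ) (lam : ℝ) : Set (M.Vh k) :=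
  {u | ∀ v : M.Vh k, M.aForm u v + M.stab σ u v = lam * M.bForm u v}

/-- `lam` is a (finite) discrete eigenvalue. -/
def IsEigenvalue (σ : ℝ) (k : ℕ) (lam : ℝ) : Prop :=
  ∃ u ∈ M.eigenvectors σ k lam, u ≠ 0

/-- The multiplicity of `lam`: the dimension of the space of solutions of the discrete eigenvalue
problem. -/
def multiplicity (σ : ℝ) (k : ℕ) (lam : ℝ) : ℕ := Set.finrank ℝ (M.eigenvectors σ k lam)

/-- The `j`-th discrete eigenvalue in `[0, ∞]` by the Rayleigh-Ritz principle: the minimum over all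
`j`-dimensional subspaces `W` of the maximum over `v ∈ W \ {0}` of
`(a_h(v, v) + s_h(v, v)) / b_h(v, v)`, which is `∞` if `b_h(v, v) = 0`. -/
def rayleighRitz (σ : ℝ) (k j : ℕ) : ℝ≥0∞ :=
  ⨅ (W : Submodule ℝ (M.Vh k)) (_ : Module.finrank ℝ W = j),
    ⨆ (v : M.Vh k) (_ : v ∈ W) (_ : v ≠ 0),
      ENNReal.ofReal (M.aForm v v + M.stab σ v v) / ENNReal.ofReal (M.bForm v v)

end PolytopalMesh

end HHO

end

noncomputable section

namespace HHO

/-! The reconstruction is the Riesz representative for `meanForm`, which is `aPw` plus the products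
of the cell integrals. This form is definite, because zero energy leaves piecewise constants and
zero cell integrals remove them. Testing with cell indicators, which annihilate both `aPw` and
`load`, gives the integral condition. The added terms then cancel. Uniqueness makes `recon` linear,
so `a_h + s_h` is bilinear; it is symmetric because the `L²` projection is self-adjoint.

For definiteness, suppose the energy of `v` vanishes. Then `recon v` is piecewise constant and
equals the cell part of `v`. On a side of a cell the defect is therefore a polynomial of degree at
most `k`, so its vanishing projection (the weights are positive, `weight_pos`) forces the side value
to equal the constant of the cell. The constants thus agree across interior sides and vanish at
boundary sides.

That such constants are zero is `eq_zero_of_no_jumps`. A line generic for all cell vertices is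
followed to its last point in the cells sharing a nonzero value. It crosses the side found there
from one cell into another. At an interior side the next cell has the same value, so the point was
not the last one. At a boundary side either the value is zero or two cells fill a neighbourhood of
the point, which the Lipschitz property excludes (`interior_closure`).

For the counts, `a_h + s_h` and `b_h` are diagonalized simultaneously, with entries `1` and `μ i`.
Finite eigenvalues solve `lam * μ i = 1`, so they number the rank of `b_h`. This rank is the
dimension of the cell space, because the kernel of `b_h` consists of the pairs with zero cell part.
A Rayleigh-Ritz value is infinite exactly when the dimension forces every competing subspace to meet
this kernel. -/

theorem bijective_of_posDef {V : Type*} [AddCommGroup V] [Module ℝ V] [FiniteDimensional ℝ V]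
    (B : LinearMap.BilinForm ℝ V) (h : ∀ v, B v v = 0 → v = 0) : Function.Bijective B := by
  have hinj : Function.Injective B := by
    rw [injective_iff_map_eq_zero]
    intro p hp
    exact h p (by rw [hp]; rfl)
  exact ⟨hinj, (LinearMap.injective_iff_surjective_of_finrank_eq_finrank
    (Subspace.dual_finrank_eq (K := ℝ) (V := V)).symm).1 hinj⟩

/-! ### Generalized eigenvalue problems with a semidefinite right-hand side -/

section GeneralizedEigenvalues

variable {V : Type*} [AddCommGroup V] [Module ℝ V]

/-- Simultaneous diagonalization of a scalar product and a symmetric bilinear form. -/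
theorem exists_simultaneous_diagonalization [FiniteDimensional ℝ V]
    (B b : LinearMap.BilinForm ℝ V) (hB : B.IsSymm)
    (hpos : ∀ v, v ≠ 0 → 0 < B v v) (hb : b.IsSymm) :
    ∃ (e : Module.Basis (Fin (Module.finrank ℝ V)) ℝ V) (μ : Fin (Module.finrank ℝ V) → ℝ),
      (∀ u v, B u v = ∑ i, e.repr u i * e.repr v i) ∧
      ∀ u v, b u v = ∑ i, μ i * (e.repr u i * e.repr v i) := by
  have hnn : ∀ v, 0 ≤ B v v := fun v => by
    by_cases h : v = 0
    · simp [h]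
    · exact (hpos v h).le
  let core : InnerProductSpace.Core ℝ V :=
    { inner := fun u v => B u v
      conj_inner_symm := fun u v => by simpa using hB.eq v u
      re_inner_nonneg := fun v => by simpa using hnn v
      add_left := fun u v w => by simp
      smul_left := fun u v r => by simp
      definite := fun v hv => by
        by_contra h
        exact (hpos v h).ne' hv }
  let : NormedAddCommGroup V := core.toNormedAddCommGroup
  let : InnerProductSpace ℝ V := InnerProductSpace.ofCore core.toCore
  have hin : ∀ u v : V, inner ℝ u v = B u v := fun u v => rfl
  have hnd : B.Nondegenerate := by
    refine ⟨fun v hv => ?_, fun v hv => ?_⟩ <;>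
    · by_contra h
      exact (hpos v h).ne' (hv v)
  -- With `B` as inner product, `T` represents `b`; the spectral theorem for `T` yields the basis.
  let T : V →ₗ[ℝ] V := (B.toDual hnd).symm.toLinearMap ∘ₗ b
  have hT : ∀ u v, B (T u) v = b u v := fun u v => by
    simp [T]
  have hTs : T.IsSymmetric := fun u v => by
    rw [hin, hin, hT, ← hB.eq, hT]
    simpa using hb.eq u v
  let e := hTs.eigenvectorBasis rfl
  refine ⟨e.toBasis, hTs.eigenvalues rfl, fun u v => ?_, fun u v => ?_⟩
  · rw [← hin, ← e.sum_inner_mul_inner]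
    simp only [OrthonormalBasis.coe_toBasis_repr_apply, OrthonormalBasis.repr_apply_apply]
    exact Finset.sum_congr rfl fun i _ => by rw [real_inner_comm]
  · rw [← hT, ← hin, ← e.sum_inner_mul_inner]
    simp only [OrthonormalBasis.coe_toBasis_repr_apply]
    refine Finset.sum_congr rfl fun i _ => ?_
    rw [real_inner_comm, ← OrthonormalBasis.repr_apply_apply,
      hTs.eigenvectorBasis_apply_self_apply, e.repr_apply_apply v]
    simp [e, mul_assoc]

/-- The solutions of the generalized eigenvalue problem `B u = lam • b u`. -/
def genEigenspace (B b : LinearMap.BilinForm ℝ V) (lam : ℝ) : Submodule ℝ V :=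
  LinearMap.ker (B - lam • b)

theorem mem_genEigenspace {B b : LinearMap.BilinForm ℝ V} {lam : ℝ} {u : V} :
    u ∈ genEigenspace B b lam ↔ ∀ v, B u v = lam * b u v := by
  simp [genEigenspace, LinearMap.ext_iff, sub_eq_zero]

theorem finrank_setOf_repr_eq_zero {ι : Type*} [Fintype ι] (e : Module.Basis ι ℝ V)
    (s : Finset ι) (W : Submodule ℝ V) (hW : ∀ u, u ∈ W ↔ ∀ i ∉ s, e.repr u i = 0) :
    Module.finrank ℝ W = s.card := by
  have : W = Submodule.span ℝ (Set.range fun i : s => e i) := by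
    have h2 : (Set.range fun i : s => e i) = e '' (s : Set ι) := by
      ext x; simp
    ext u
    rw [hW, h2, e.mem_span_image]
    constructor
    · intro h i hi
      by_contra h3
      exact (Finsupp.mem_support_iff.1 hi) (h i h3)
    · intro h i hi
      by_contra h3
      exact hi (h (Finsupp.mem_support_iff.2 h3))
  have hli : LinearIndependent ℝ (fun i : s => e i) :=
    e.linearIndependent.comp _ Subtype.val_injective
  rw [this, finrank_span_eq_card hli]
  simp

variable {B b : LinearMap.BilinForm ℝ V} {e : Module.Basis (Fin (Module.finrank ℝ V)) ℝ V}
  {μ : Fin (Module.finrank ℝ V) → ℝ}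

/-- In coordinates the problem decouples into `(lam * μ i - 1) * u i = 0`, so each index with `lam *
μ i = 1` contributes one dimension. -/
theorem finrank_genEigenspace (hBe : ∀ u v, B u v = ∑ i, e.repr u i * e.repr v i)
    (hbe : ∀ u v, b u v = ∑ i, μ i * (e.repr u i * e.repr v i)) (lam : ℝ) :
    Module.finrank ℝ (genEigenspace B b lam) = {i | lam * μ i = 1}.toFinset.card := by
  refine finrank_setOf_repr_eq_zero e _ _ fun u => ?_
  rw [mem_genEigenspace]
  simp only [Set.mem_toFinset, Set.mem_ofPred_eq]
  constructor
  · intro h i hi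
    have := h (e i)
    simp only [hBe, hbe, Module.Basis.repr_self, Finsupp.single_apply] at this
    simp at this
    have h2 : (lam * μ i - 1) * e.repr u i = 0 := by linarith
    exact (mul_eq_zero.1 h2).resolve_left (sub_ne_zero.2 hi)
  · intro h v
    rw [hBe, hbe, Finset.mul_sum]
    refine Finset.sum_congr rfl fun i _ => ?_
    by_cases hi : lam * μ i = 1
    · rw [← mul_assoc, hi, one_mul]
    · simp [h i hi]

theorem finrank_ker_of_diagonal (hbe : ∀ u v, b u v = ∑ i, μ i * (e.repr u i * e.repr v i)) :
    Module.finrank ℝ (LinearMap.ker b) = {i | μ i = 0}.toFinset.card := by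
  refine finrank_setOf_repr_eq_zero e _ _ fun u => ?_
  simp only [Set.mem_toFinset, Set.mem_ofPred_eq, LinearMap.mem_ker]
  constructor
  · intro h i hi
    have := hbe u (e i)
    simp only [h, Module.Basis.repr_self, Finsupp.single_apply] at this
    simp at this
    exact this.resolve_left hi
  · intro h
    ext v
    rw [hbe]
    refine Finset.sum_eq_zero fun i _ => ?_
    by_cases hi : μ i = 0
    · simp [hi]
    · simp [h i hi]

theorem card_ne_zero_of_diagonal [FiniteDimensional ℝ V]
    (hbe : ∀ u v, b u v = ∑ i, μ i * (e.repr u i * e.repr v i)) :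
    {i | μ i ≠ 0}.toFinset.card = Module.finrank ℝ (LinearMap.range b) := by
  have h1 := LinearMap.finrank_range_add_finrank_ker b
  rw [finrank_ker_of_diagonal hbe] at h1
  have h2 := Finset.card_filter_add_card_filter_not (s := Finset.univ) (fun i => μ i = 0)
  simp only [Set.toFinset_ofPred, Finset.card_univ, Fintype.card_fin, ne_eq] at *
  omega

/-- The finite eigenvalues of `B u = lam • b u`: there are finitely many, and their multiplicities
add up to the rank of `b`. -/
theorem sum_finrank_genEigenspace [FiniteDimensional ℝ V] (B b : LinearMap.BilinForm ℝ V) (hB : B.IsSymm)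
    (hpos : ∀ v, v ≠ 0 → 0 < B v v) (hb : b.IsSymm) :
    {lam : ℝ | genEigenspace B b lam ≠ ⊥}.Finite ∧
    ∑ᶠ lam : ℝ, Module.finrank ℝ (genEigenspace B b lam) =
      Module.finrank ℝ (LinearMap.range b) := by
  obtain ⟨e, μ, hBe, hbe⟩ := exists_simultaneous_diagonalization B b hB hpos hb
  -- Indices with `μ i = 0` put the default inverse `0` into `F`. This is harmless, since `0 * μ i =
  -- 1` has no solution.
  set F : Finset ℝ := Finset.univ.image fun i => (μ i)⁻¹ with hF
  have hzero : ∀ lam, lam ∉ F → Module.finrank ℝ (genEigenspace B b lam) = 0 := by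
    intro lam hlam
    rw [finrank_genEigenspace hBe hbe, Finset.card_eq_zero]
    ext i
    simp only [Set.mem_toFinset, Set.mem_ofPred_eq, Finset.notMem_empty, iff_false]
    intro h
    exact hlam (Finset.mem_image.2 ⟨i, Finset.mem_univ _, (eq_inv_of_mul_eq_one_left h).symm⟩)
  constructor
  · refine F.finite_toSet.subset fun lam hlam => ?_
    by_contra h
    exact hlam (Submodule.finrank_eq_zero.1 (hzero lam h))
  · rw [finsum_eq_sum_of_support_subset (s := F) _ fun lam hlam => by
      by_contra h
      exact hlam (hzero lam h)]
    rw [← card_ne_zero_of_diagonal hbe]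
    -- The indices with `μ i ≠ 0` are sorted by their eigenvalue `(μ i)⁻¹`.
    rw [Finset.card_eq_sum_card_fiberwise (f := fun i => (μ i)⁻¹) (t := F)
      (fun i _ => Finset.mem_image.2 ⟨i, Finset.mem_univ _, rfl⟩)]
    refine Finset.sum_congr rfl fun lam _ => ?_
    rw [finrank_genEigenspace hBe hbe]
    congr 1
    ext i
    simp only [Set.mem_toFinset, Set.mem_ofPred_eq, Finset.mem_filter]
    constructor
    · intro h
      exact ⟨right_ne_zero_of_mul_eq_one h, (eq_inv_of_mul_eq_one_left h).symm⟩
    · rintro ⟨h1, rfl⟩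
      exact inv_mul_cancel₀ h1

theorem nonneg_of_diagonal (hbe : ∀ u v, b u v = ∑ i, μ i * (e.repr u i * e.repr v i))
    (hnn : ∀ v, 0 ≤ b v v) (i : Fin (Module.finrank ℝ V)) : 0 ≤ μ i := by
  have := hnn (e i)
  simpa [hbe, Finsupp.single_apply] using this

/-- The Rayleigh-Ritz value of index `j` of a scalar product `B` and a positive semidefinite form
`b` is finite if and only if `j` is at most the rank of `b`. -/
theorem rayleighRitz_lt_top_iff [FiniteDimensional ℝ V] (B b : LinearMap.BilinForm ℝ V) (hB : B.IsSymm)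
    (hpos : ∀ v, v ≠ 0 → 0 < B v v) (hb : b.IsSymm) (hnn : ∀ v, 0 ≤ b v v) (j : ℕ) :
    (⨅ (W : Submodule ℝ V) (_ : Module.finrank ℝ W = j),
      ⨆ (v : V) (_ : v ∈ W) (_ : v ≠ 0), ENNReal.ofReal (B v v) / ENNReal.ofReal (b v v)) < ⊤ ↔
      j ≤ Module.finrank ℝ (LinearMap.range b) := by
  obtain ⟨e, μ, hBe, hbe⟩ := exists_simultaneous_diagonalization B b hB hpos hb
  have hμ := nonneg_of_diagonal hbe hnn
  constructor
  · intro h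
    simp only [iInf_lt_iff] at h
    obtain ⟨W, hW, hlt⟩ := h
    by_contra hj
    have h1 := LinearMap.finrank_range_add_finrank_ker b
    have h2 := Submodule.finrank_sup_add_finrank_inf_eq W (LinearMap.ker b)
    have h3 := Submodule.finrank_le (W ⊔ LinearMap.ker b)
    -- The dimensions of `W` and of the kernel add up to more than that of `V`.
    have h4 : W ⊓ LinearMap.ker b ≠ ⊥ := fun h => by
      rw [h, finrank_bot] at h2
      omega
    obtain ⟨v, hv, hv0⟩ := Submodule.exists_mem_ne_zero_of_ne_bot h4
    refine absurd hlt (not_lt.2 (top_le_iff.2 ?_))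
    rw [eq_top_iff]
    refine le_trans ?_ (le_iSup₂_of_le v hv.1 (le_iSup_of_le hv0 le_rfl))
    have : b v v = 0 := by
      have := hv.2
      rw [SetLike.mem_coe, LinearMap.mem_ker] at this
      simp [this]
    rw [this, ENNReal.ofReal_zero, ENNReal.div_zero]
    simpa using hpos v hv0
  · intro h
    rw [← card_ne_zero_of_diagonal hbe] at h
    obtain ⟨s, hs, hcard⟩ := Finset.exists_subset_card_eq h
    -- The competitor is spanned by `j` eigenvectors with `μ i > 0`.
    let W : Submodule ℝ V := Submodule.span ℝ (e '' (s : Set _))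
    have hWm : ∀ u, u ∈ W ↔ ∀ i ∉ s, e.repr u i = 0 := fun u => by
      rw [e.mem_span_image]
      refine ⟨fun h i hi => ?_, fun h i hi => ?_⟩
      · by_contra h3
        exact hi (h (Finsupp.mem_support_iff.2 h3))
      · by_contra h3
        exact (Finsupp.mem_support_iff.1 hi) (h i h3)
    have hW : Module.finrank ℝ W = j := by
      rw [finrank_setOf_repr_eq_zero e s W hWm, hcard]
    simp only [iInf_lt_iff]
    refine ⟨W, hW, ?_⟩
    have hs' : ∀ i ∈ s, 0 < μ i := fun i hi =>
      lt_of_le_of_ne (hμ i) (by simpa using (hs hi) : μ i ≠ 0).symm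
    -- The sum of the inverses is a crude substitute for their maximum; only finiteness of the bound
    -- matters.
    set C : ℝ := ∑ i ∈ s, (μ i)⁻¹ with hC
    have hC0 : 0 ≤ C := Finset.sum_nonneg fun i hi => (inv_pos.2 (hs' i hi)).le
    have hCi : ∀ i ∈ s, 1 ≤ C * μ i := fun i hi => by
      have : (μ i)⁻¹ ≤ C :=
        Finset.single_le_sum (f := fun i => (μ i)⁻¹) (fun i hi => (inv_pos.2 (hs' i hi)).le) hi
      calc (1 : ℝ) = (μ i)⁻¹ * μ i := (inv_mul_cancel₀ (hs' i hi).ne').symm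
        _ ≤ _ := mul_le_mul_of_nonneg_right this (hs' i hi).le
    have hle : ∀ v ∈ W, B v v ≤ C * b v v := fun v hv => by
      rw [hBe, hbe, Finset.mul_sum]
      refine Finset.sum_le_sum fun i _ => ?_
      by_cases hi : i ∈ s
      · nlinarith [hCi i hi, mul_self_nonneg (e.repr v i)]
      · simp [(hWm v).1 hv i hi]
    refine lt_of_le_of_lt (b := ENNReal.ofReal C) ?_ ENNReal.ofReal_lt_top
    refine iSup₂_le fun v hv => iSup_le fun hv0 => ?_
    refine ENNReal.div_le_of_le_mul ?_
    rw [← ENNReal.ofReal_mul hC0]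
    exact ENNReal.ofReal_le_ofReal (hle v hv)

end GeneralizedEigenvalues

/-! ### Polynomials and integrals on cells -/

section Polynomials

variable {n : ℕ}

@[simp] theorem polyEval_add (p q : MvPolynomial (Fin n) ℝ) (x : Space n) :
    polyEval (p + q) x = polyEval p x + polyEval q x := by simp [polyEval]

@[simp] theorem polyEval_sub (p q : MvPolynomial (Fin n) ℝ) (x : Space n) :
    polyEval (p - q) x = polyEval p x - polyEval q x := by simp [polyEval]

@[simp] theorem polyEval_smul (c : ℝ) (p : MvPolynomial (Fin n) ℝ) (x : Space n) :
    polyEval (c • p) x = c * polyEval p x := by simp [polyEval]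

@[simp] theorem polyEval_zero (x : Space n) :
    polyEval (0 : MvPolynomial (Fin n) ℝ) x = 0 := by simp [polyEval]

@[simp] theorem polyEval_C (c : ℝ) (x : Space n) :
    polyEval (MvPolynomial.C c) x = c := by simp [polyEval]

@[simp] theorem polyGrad_add (p q : MvPolynomial (Fin n) ℝ) (x : Space n) :
    polyGrad (p + q) x = polyGrad p x + polyGrad q x := by ext; simp [polyGrad]

@[simp] theorem polyGrad_smul (c : ℝ) (p : MvPolynomial (Fin n) ℝ) (x : Space n) :
    polyGrad (c • p) x = c • polyGrad p x := by ext; simp [polyGrad]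

@[simp] theorem polyGrad_C (c : ℝ) (x : Space n) :
    polyGrad (MvPolynomial.C c) x = 0 := by ext; simp [polyGrad]

@[simp] theorem polyLaplacian_add (p q : MvPolynomial (Fin n) ℝ) :
    polyLaplacian (p + q) = polyLaplacian p + polyLaplacian q := by
  simp [polyLaplacian, Finset.sum_add_distrib]

@[simp] theorem polyLaplacian_smul (c : ℝ) (p : MvPolynomial (Fin n) ℝ) :
    polyLaplacian (c • p) = c • polyLaplacian p := by
  simp [polyLaplacian, Finset.smul_sum]

@[simp] theorem polyLaplacian_zero : polyLaplacian (0 : MvPolynomial (Fin n) ℝ) = 0 := by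
  simp [polyLaplacian]

@[simp] theorem polyLaplacian_C (c : ℝ) :
    polyLaplacian (MvPolynomial.C c : MvPolynomial (Fin n) ℝ) = 0 := by
  simp [polyLaplacian]

@[fun_prop] theorem continuous_polyEval (p : MvPolynomial (Fin n) ℝ) :
    Continuous (polyEval p) := by
  have := MvPolynomial.continuous_eval p
  exact this.comp (by fun_prop)

@[fun_prop] theorem continuous_polyGrad (p : MvPolynomial (Fin n) ℝ) :
    Continuous (polyGrad p) := by
  refine (PiLp.continuous_toLp 2 _).comp ?_
  exact continuous_pi fun i => continuous_polyEval _

/-- A polynomial that vanishes on a nonempty open set is zero. -/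
theorem eq_zero_of_polyEval_eq_zero {p : MvPolynomial (Fin n) ℝ} {U : Set (Space n)}
    (hU : IsOpen U) (hne : U.Nonempty) (h : ∀ x ∈ U, polyEval p x = 0) : p = 0 := by
  obtain ⟨x, hx⟩ := hne
  have hU' : IsOpen ((WithLp.toLp 2 : (Fin n → ℝ) → Space n) ⁻¹' U) :=
    hU.preimage (PiLp.continuous_toLp 2 _)
  obtain ⟨ε, hε, hball⟩ := Metric.isOpen_iff.1 hU' (WithLp.ofLp x) (by simpa using hx)
  -- The open set contains a ball of the sup norm, a product of infinite sets.
  refine MvPolynomial.funext_set (fun i => Metric.ball (x i) ε) (fun i => ?_) fun y hy => ?_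
  · rw [Real.ball_eq_Ioo]
    exact Set.Ioo_infinite (by linarith)
  · have : y ∈ Metric.ball (WithLp.ofLp x) ε := by
      rw [ball_pi _ hε]
      exact hy
    simpa [polyEval] using h _ (hball this)

/-- A polynomial whose gradient vanishes on a nonempty open set is constant. -/
theorem eq_C_of_polyGrad_eq_zero {p : MvPolynomial (Fin n) ℝ} {U : Set (Space n)}
    (hU : IsOpen U) (hne : U.Nonempty) (h : ∀ x ∈ U, polyGrad p x = 0) :
    p = MvPolynomial.C (MvPolynomial.coeff 0 p) := by
  have hp : ∀ i, MvPolynomial.pderiv i p = 0 := fun i =>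
    eq_zero_of_polyEval_eq_zero hU hne fun x hx => by
      have := congrArg (fun v : Space n => v i) (h x hx)
      simpa [polyGrad] using this
  ext m
  rw [MvPolynomial.coeff_C]
  split_ifs with hm
  · rw [hm]
  · obtain ⟨i, hi⟩ : ∃ i, m i ≠ 0 := by
      by_contra! hcon
      exact hm (by ext i; simp [hcon i])
    -- This coefficient of the derivative is a nonzero multiple of the coefficient of `p` at `m`.
    have h1 := congrArg (MvPolynomial.coeff (m - Finsupp.single i 1)) (hp i)
    rw [MvPolynomial.coeff_pderiv] at h1
    have h2 : m - Finsupp.single i 1 + Finsupp.single i 1 = m := by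
      refine tsub_add_cancel_of_le ?_
      rw [Finsupp.single_le_iff]
      omega
    rw [h2] at h1
    simp only [MvPolynomial.coeff_zero, mul_eq_zero] at h1
    refine h1.resolve_right ?_
    positivity

/-- A continuous nonnegative function with vanishing integral over a compact set vanishes in the
interior of this set. -/
theorem eq_zero_of_setIntegral_eq_zero {K : Set (Space n)} (hK : IsCompact K)
    {f : Space n → ℝ} (hf : Continuous f) (h0 : ∀ x, 0 ≤ f x) (h : ∫ x in K, f x = 0) :
    ∀ x ∈ interior K, f x = 0 := by
  have h1 : f =ᵐ[volume.restrict K] 0 :=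
    (integral_eq_zero_iff_of_nonneg h0 (hf.continuousOn.integrableOn_compact hK)).1 h
  have h2 : f =ᵐ[volume.restrict (interior K)] fun _ => 0 :=
    ae_restrict_of_ae_restrict_of_subset interior_subset h1
  exact Measure.eqOn_open_of_ae_eq h2 isOpen_interior hf.continuousOn continuousOn_const

theorem cellInner_self_nonneg (K : Set (Space n)) (f : Space n → ℝ) : 0 ≤ cellInner K f f :=
  integral_nonneg fun x => mul_self_nonneg (f x)

theorem cellInner_comm (K : Set (Space n)) (f g : Space n → ℝ) :
    cellInner K f g = cellInner K g f := by simp [cellInner, mul_comm]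

theorem cellInner_add_left {K : Set (Space n)} (hK : IsCompact K) {f₁ f₂ g : Space n → ℝ}
    (h₁ : Continuous f₁) (h₂ : Continuous f₂) (hg : Continuous g) :
    cellInner K (fun x => f₁ x + f₂ x) g = cellInner K f₁ g + cellInner K f₂ g := by
  simp only [cellInner, add_mul]
  exact integral_add ((h₁.mul hg).continuousOn.integrableOn_compact hK)
    ((h₂.mul hg).continuousOn.integrableOn_compact hK)

theorem cellInner_smul_left (K : Set (Space n)) (c : ℝ) (f g : Space n → ℝ) :
    cellInner K (fun x => c * f x) g = c * cellInner K f g := by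
  simp only [cellInner, mul_assoc]
  exact integral_const_mul _ _

theorem eq_zero_of_cellInner_self_eq_zero {K : Set (Space n)} (hK : IsCompact K)
    (hne : (interior K).Nonempty) {p : MvPolynomial (Fin n) ℝ}
    (h : cellInner K (polyEval p) (polyEval p) = 0) : p = 0 := by
  have h1 := eq_zero_of_setIntegral_eq_zero (f := fun x => polyEval p x * polyEval p x) hK
    (by fun_prop) (fun x => mul_self_nonneg _) h
  exact eq_zero_of_polyEval_eq_zero isOpen_interior hne fun x hx => mul_self_eq_zero.1 (h1 x hx)

theorem IsConvexPolytope.isCompact {K : Set (Space n)} (h : IsConvexPolytope K) :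
    IsCompact K := by
  obtain ⟨t, rfl⟩ := h
  exact t.finite_toSet.isCompact_convexHull (𝕜 := ℝ)

theorem IsConvexPolytope.convex {K : Set (Space n)} (h : IsConvexPolytope K) : Convex ℝ K := by
  obtain ⟨t, rfl⟩ := h
  exact convex_convexHull ℝ _

theorem C_mem_Poly (m : ℕ) (c : ℝ) : MvPolynomial.C c ∈ Poly n m := by
  simp [MvPolynomial.mem_restrictTotalDegree]

end Polynomials

/-! ### Generic lines through polytopes -/

section GenericLines

open Filter Topology

variable {E : Type*} [NormedAddCommGroup E] [NormedSpace ℝ E]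

/-- The line through `p` in direction `d` is generic for the finite set `t`: if it meets the affine
hull of some points of `t`, then this affine hull and `d` span the whole space. -/
def IsGeneric (t : Finset E) (d p : E) : Prop :=
  ∀ s ⊆ t, ∀ v ∈ t, p - v ∈ Submodule.span ℝ (insert d ((fun y => y - v) '' (s : Set E))) →
    Submodule.span ℝ (insert d ((fun y => y - v) '' (s : Set E))) = ⊤

theorem IsGeneric.mono {t t' : Finset E} {d p : E} (h : IsGeneric t d p) (ht : t' ⊆ t) :
    IsGeneric t' d p := fun s hs v hv => h s (hs.trans ht) v (ht hv)

theorem IsGeneric.add_smul {t : Finset E} {d p : E} (h : IsGeneric t d p) (r : ℝ) :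
    IsGeneric t d (p + r • d) := fun s hs v hv hp => h s hs v hv <| by
  have hd : r • d ∈ Submodule.span ℝ (insert d ((fun y => y - v) '' (s : Set E))) :=
    Submodule.smul_mem _ _ (Submodule.subset_span (Set.mem_insert _ _))
  have := Submodule.sub_mem _ hp hd
  rwa [show p + r • d - v - r • d = p - v by abel] at this

/-- The nongeneric points lie in finitely many proper affine subspaces, which are null sets and
cannot cover a nonempty open set. -/
theorem exists_isGeneric [FiniteDimensional ℝ E] (t : Finset E) (d : E) {U : Set E}
    (hU : IsOpen U) (hne : U.Nonempty) : ∃ p ∈ U, IsGeneric t d p := by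
  let : MeasurableSpace E := borel E
  have : BorelSpace E := ⟨rfl⟩
  let ν : Measure E := Measure.addHaar
  by_contra! hcon
  have hsub : U ⊆ ⋃ s ∈ t.powerset, ⋃ v ∈ t,
      {p | p - v ∈ Submodule.span ℝ (insert d ((fun y => y - v) '' (s : Set E))) ∧
        Submodule.span ℝ (insert d ((fun y => y - v) '' (s : Set E))) ≠ ⊤} := by
    intro p hp
    have := hcon p hp
    simp only [IsGeneric, not_forall] at this
    obtain ⟨s, hs, v, hv, h1, h2⟩ := this
    simp only [Set.mem_iUnion]
    exact ⟨s, Finset.mem_powerset.2 hs, v, hv, h1, h2⟩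
  have hnull : ν U = 0 := by
    refine measure_mono_null hsub ?_
    refine (measure_biUnion_null_iff t.powerset.countable_toSet).2 fun s _ => ?_
    refine (measure_biUnion_null_iff t.countable_toSet).2 fun v _ => ?_
    by_cases hW : Submodule.span ℝ (insert d ((fun y => y - v) '' (s : Set E))) = ⊤
    · simp [hW]
    · refine measure_mono_null (t := (AffineSubspace.mk' v
        (Submodule.span ℝ (insert d ((fun y => y - v) '' (s : Set E)))) : Set E)) ?_
        (Measure.addHaar_affineSubspace ν _ ?_)
      · rintro p ⟨hp, -⟩
        simpa [AffineSubspace.mem_mk'] using hp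
      · intro htop
        have := congrArg AffineSubspace.direction htop
        rw [AffineSubspace.direction_mk', AffineSubspace.direction_top] at this
        exact hW this
  exact (hU.measure_pos ν hne).ne' hnull

/-- A point of a polytope on a generic line is a positive convex combination of points that span
the whole space together with the direction of the line. -/
theorem IsGeneric.exists_weights {t : Finset E} {d x : E} (h : IsGeneric t d x)
    (hx : x ∈ convexHull ℝ (t : Set E)) :
    ∃ s ⊆ t, ∃ w : E → ℝ, (∀ y ∈ s, 0 < w y) ∧ ∑ y ∈ s, w y = 1 ∧ ∑ y ∈ s, w y • y = x ∧
      Submodule.span ℝ (insert d ((fun y => y - x) '' (s : Set E))) = ⊤ := by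
  -- Discarding the vertices of zero weight leaves `x` in the relative interior of the hull of `s`.
  obtain ⟨w, hw0, hw1, hwx⟩ := Finset.mem_convexHull'.1 hx
  set s := t.filter fun y => 0 < w y with hs
  have hz : ∀ y ∈ t, y ∉ s → w y = 0 := fun y hy hys => by
    have : ¬ 0 < w y := fun hpos => hys (Finset.mem_filter.2 ⟨hy, hpos⟩)
    exact le_antisymm (not_lt.1 this) (hw0 y hy)
  have hst : s ⊆ t := Finset.filter_subset _ _
  have h1 : ∑ y ∈ s, w y = 1 := by rw [← hw1]; exact Finset.sum_subset hst hz
  have hx' : ∑ y ∈ s, w y • y = x := by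
    rw [← hwx]
    exact Finset.sum_subset hst fun y hy hys => by rw [hz y hy hys, zero_smul]
  refine ⟨s, hst, w, fun y hy => (Finset.mem_filter.1 hy).2, h1, hx', ?_⟩
  obtain ⟨v, hv⟩ : s.Nonempty := by
    by_contra hcon
    rw [Finset.not_nonempty_iff_eq_empty] at hcon
    rw [hcon] at h1
    simp at h1
  have hmem : x - v ∈ Submodule.span ℝ (insert d ((fun y => y - v) '' (s : Set E))) := by
    have : x - v = ∑ y ∈ s, w y • (y - v) := by
      simp only [smul_sub, Finset.sum_sub_distrib, ← Finset.sum_smul, h1, hx', one_smul]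
    rw [this]
    exact Submodule.sum_mem _ fun y hy => Submodule.smul_mem _ _
      (Submodule.subset_span (Set.mem_insert_of_mem _ ⟨y, hy, rfl⟩))
  -- Genericity gives the span with base point `v`; the base point is moved to `x` by `y - v = (y -
  -- x) - (v - x)`.
  rw [eq_top_iff, ← h s hst v (hst hv) hmem, Submodule.span_le]
  rintro z (rfl | ⟨y, hy, rfl⟩)
  · exact Submodule.subset_span (Set.mem_insert _ _)
  · have h2 : ∀ y ∈ s, y - x ∈ Submodule.span ℝ (insert d ((fun y => y - x) '' (s : Set E))) :=
      fun y hy => Submodule.subset_span (Set.mem_insert_of_mem _ ⟨y, hy, rfl⟩)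
    have := Submodule.sub_mem _ (h2 y hy) (h2 v hv)
    simpa using this

/-- The value at `x` is an average with positive weights of values that do not exceed it. A
functional that is maximal at `x` is hence constant on the face carrying `x`. -/
theorem apply_eq_of_weights {s : Finset E} {w : E → ℝ} {x : E} (hw : ∀ y ∈ s, 0 < w y)
    (h1 : ∑ y ∈ s, w y = 1) (hx : ∑ y ∈ s, w y • y = x) (f : StrongDual ℝ E)
    (hf : ∀ y ∈ s, f y ≤ f x) : ∀ y ∈ s, f y = f x := by
  have h2 : ∑ y ∈ s, w y * (f x - f y) = 0 := by
    have : f x = ∑ y ∈ s, w y * f y := by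
      conv_lhs => rw [← hx]
      simp
    simp only [mul_sub, Finset.sum_sub_distrib, ← Finset.sum_mul, h1, one_mul, ← this, sub_self]
  intro y hy
  have h3 := (Finset.sum_eq_zero_iff_of_nonneg fun y hy =>
    mul_nonneg (hw y hy).le (sub_nonneg.2 (hf y hy))).1 h2 y hy
  have := (mul_eq_zero.1 h3).resolve_left (hw y hy).ne'
  linarith

theorem eq_zero_of_span_insert {s : Finset E} {d x : E} {f : StrongDual ℝ E}
    (hspan : Submodule.span ℝ (insert d ((fun y => y - x) '' (s : Set E))) = ⊤)
    (hd : f d = 0) (hf : ∀ y ∈ s, f y = f x) : f = 0 := by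
  ext z
  have : Submodule.span ℝ (insert d ((fun y => y - x) '' (s : Set E))) ≤
      LinearMap.ker (f : E →ₗ[ℝ] ℝ) := by
    rw [Submodule.span_le]
    rintro z (rfl | ⟨y, hy, rfl⟩)
    · exact hd
    · simp [hf y hy]
  rw [hspan] at this
  exact this (Submodule.mem_top (x := z))

theorem le_of_forall_interior {K : Set E} (hK : Convex ℝ K) (hne : (interior K).Nonempty)
    {f : StrongDual ℝ E} {u : ℝ} (h : ∀ a ∈ interior K, f a ≤ u) : ∀ a ∈ K, f a ≤ u := by
  intro a ha
  have h1 : a ∈ closure (interior K) := by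
    rw [hK.closure_interior_eq_closure_of_nonempty_interior hne]
    exact subset_closure ha
  exact closure_minimal h (isClosed_le f.continuous continuous_const) h1

/-- A generic line that meets a polytope with nonempty interior meets this interior. -/
theorem IsGeneric.exists_mem_interior {t : Finset E} {d x : E} (h : IsGeneric t d x)
    (hx : x ∈ convexHull ℝ (t : Set E)) (hne : (interior (convexHull ℝ (t : Set E))).Nonempty) :
    ∃ r : ℝ, x + r • d ∈ interior (convexHull ℝ (t : Set E)) := by
  by_contra! hcon
  have hK := convex_convexHull ℝ (t : Set E)
  have hline : Convex ℝ (Set.range fun r : ℝ => x + r • d) := by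
    rintro _ ⟨r, rfl⟩ _ ⟨r', rfl⟩ a b _ _ hab
    refine ⟨a * r + b * r', ?_⟩
    obtain rfl : b = 1 - a := by linarith
    dsimp only
    module
  -- If the line missed the interior, a separating functional would be bounded below on the line,
  -- hence vanish on `d`. It would also be constant on `s`, so genericity would make it zero.
  obtain ⟨f, u, hf, hu⟩ := geometric_hahn_banach_open hK.interior isOpen_interior hline
    (Set.disjoint_left.2 fun a ha => by rintro ⟨r, rfl⟩; exact hcon r ha)
  have hu' : ∀ r : ℝ, u ≤ f x + r * f d := fun r => by simpa using hu _ ⟨r, rfl⟩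
  have hd : f d = 0 := by
    by_contra hd
    -- At this parameter the functional takes the value `u - 1`.
    have := hu' ((u - f x - 1) / f d)
    rw [div_mul_cancel₀ _ hd] at this
    linarith
  have hux : u ≤ f x := by simpa using hu' 0
  obtain ⟨s, hst, w, hw, h1, hwx, hspan⟩ := h.exists_weights hx
  have hle := le_of_forall_interior hK hne fun a ha => (hf a ha).le
  have hs := apply_eq_of_weights hw h1 hwx f fun y hy =>
    (hle y (subset_convexHull ℝ _ (hst hy))).trans hux
  have h0 := eq_zero_of_span_insert hspan hd hs
  obtain ⟨a, ha⟩ := hne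
  have := hf a ha
  simp only [h0, zero_apply] at this hux
  linarith

/-- Near a point in the relative interior of a facet, a convex set contains the half space given by
the supporting hyperplane. -/
theorem eventually_mem_of_weights [FiniteDimensional ℝ E] {K : Set E} (hK : Convex ℝ K)
    {s : Finset E} {w : E → ℝ} {x q : E} (hsK : (s : Set E) ⊆ K) (hw : ∀ y ∈ s, 0 < w y)
    (h1 : ∑ y ∈ s, w y = 1) (hx : ∑ y ∈ s, w y • y = x)
    (hspan : Submodule.span ℝ (insert (q - x) ((fun y => y - x) '' (s : Set E))) = ⊤)
    (f : StrongDual ℝ E) (hf : ∀ y ∈ K, f y ≤ f x) (hq : q ∈ K) (hfq : f q < f x) :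
    ∀ᶠ y in 𝓝 x, f y ≤ f x → y ∈ K := by
  have hfs := apply_eq_of_weights hw h1 hx f fun y hy => hf y (hsK hy)
  -- A displacement from `x` is written with coefficients `a` along `y - x` and `b` along `q - x`.
  -- Since `ψ` is onto, hence open, small displacements have coefficients in `N`.
  let ψ : ((s → ℝ) × ℝ) →ₗ[ℝ] E :=
    (Fintype.linearCombination ℝ (fun y : s => (y : E) - x)).coprod
      (LinearMap.toSpanSingleton ℝ E (q - x))
  have hψ : ∀ a b, ψ (a, b) = ∑ y : s, a y • ((y : E) - x) + b • (q - x) := fun a b => by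
    simp [ψ, Fintype.linearCombination_apply]
  have hsurj : Function.Surjective ψ := by
    rw [← LinearMap.range_eq_top, eq_top_iff, ← hspan, Submodule.span_le]
    rintro z (rfl | ⟨y, hy, rfl⟩)
    · exact ⟨(0, 1), by simp [hψ]⟩
    · refine ⟨(Pi.single ⟨y, hy⟩ 1, 0), ?_⟩
      rw [hψ]
      simp [Pi.single_apply, ite_smul]
  have hopen : IsOpenMap ψ := ψ.isOpenMap_of_finiteDimensional hsurj
  -- Substituting `x = ∑ w y • y` turns the displaced point into an affine combination of `s` and
  -- `q`; `N` requires its weights on `s` to be positive.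
  let N : Set ((s → ℝ) × ℝ) := {c | ∀ y : s, 0 < w y * (1 - ∑ z, c.1 z - c.2) + c.1 y}
  have hN : IsOpen N := by
    have : N = ⋂ y : s, {c | 0 < w y * (1 - ∑ z, c.1 z - c.2) + c.1 y} := by
      ext; simp [N]
    rw [this]
    exact isOpen_iInter_of_finite fun y => isOpen_lt continuous_const (by fun_prop)
  have hN0 : (0 : (s → ℝ) × ℝ) ∈ N := fun y => by simpa using hw y y.2
  have hnhds : ∀ᶠ z in 𝓝 (0 : E), z ∈ ψ '' N :=
    (hopen _ hN).mem_nhds ⟨0, hN0, map_zero ψ⟩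
  have hshift : Tendsto (fun y => y - x) (𝓝 x) (𝓝 0) := by
    have : Continuous fun y : E => y - x := by fun_prop
    simpa using this.tendsto x
  filter_upwards [hshift.eventually hnhds]
  rintro y ⟨⟨a, b⟩, hab, hy⟩ hfy
  rw [hψ] at hy
  -- The functional is constant on `s` and smaller at `q`, so the half space condition is precisely
  -- the sign of the weight `b` of `q`.
  have hb : 0 ≤ b := by
    have h2 := congrArg f hy
    simp only [map_add, map_sum, map_smul, map_sub, smul_eq_mul] at h2
    rw [Finset.sum_eq_zero fun (z : s) _ => by rw [hfs z z.2, sub_self, mul_zero]] at h2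
    nlinarith
  have h1' : ∑ z : s, w z = 1 := by rw [← h1, ← Finset.sum_coe_sort s w]
  have hx' : ∑ z : s, w z • (z : E) = x := by
    rw [← hx, ← Finset.sum_coe_sort s fun z => w z • z]
  -- In the index type `Option s`, `none` stands for `q`.
  have hmem := hK.sum_mem (t := Finset.univ)
    (w := fun o : Option s => o.elim b fun z => w z * (1 - ∑ z', a z' - b) + a z)
    (z := fun o : Option s => o.elim q fun z => (z : E))
    (by
      rintro (_ | z) _
      · exact hb
      · exact (hab z).le)
    (by
      simp only [Fintype.sum_option, Option.elim, Finset.sum_add_distrib, ← Finset.sum_mul, h1']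
      ring)
    (by
      rintro (_ | z) _
      · exact hq
      · exact hsK z.2)
  convert hmem using 1
  simp only [Fintype.sum_option, Option.elim, add_smul, Finset.sum_add_distrib]
  simp only [mul_comm (w _), mul_smul, ← Finset.smul_sum, hx']
  rw [eq_add_of_sub_eq hy.symm]
  simp only [smul_sub, Finset.sum_sub_distrib, ← Finset.sum_smul]
  module

/-- If a generic line passes from one polytope to another one at the point `x`, and if the interiors
of these polytopes are disjoint, then `x` is an interior point of their union. -/
theorem IsGeneric.union_mem_nhds [FiniteDimensional ℝ E] {t₁ t₂ : Finset E} {d x : E}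
    (h₁ : IsGeneric t₁ d x) (h₂ : IsGeneric t₂ d x)
    (hx₁ : x ∈ convexHull ℝ (t₁ : Set E)) (hx₂ : x ∈ convexHull ℝ (t₂ : Set E))
    {r₁ r₂ : ℝ} (hr₁ : r₁ < 0) (hr₂ : 0 < r₂)
    (hi₁ : x + r₁ • d ∈ interior (convexHull ℝ (t₁ : Set E)))
    (hi₂ : x + r₂ • d ∈ interior (convexHull ℝ (t₂ : Set E)))
    (hdisj : Disjoint (interior (convexHull ℝ (t₁ : Set E)))
      (interior (convexHull ℝ (t₂ : Set E)))) :
    convexHull ℝ (t₁ : Set E) ∪ convexHull ℝ (t₂ : Set E) ∈ 𝓝 x := by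
  have hK₁ := convex_convexHull ℝ (t₁ : Set E)
  have hK₂ := convex_convexHull ℝ (t₂ : Set E)
  -- The hyperplane separating the two interiors passes through `x`. Near `x` each polytope contains
  -- the closed half space on its own side, so together they fill a neighbourhood.
  obtain ⟨f, u, hf, hu⟩ := geometric_hahn_banach_open hK₁.interior isOpen_interior hK₂.interior
    hdisj
  have hle₁ := le_of_forall_interior hK₁ ⟨_, hi₁⟩ fun a ha => (hf a ha).le
  have hle₂ := le_of_forall_interior hK₂ ⟨_, hi₂⟩ (f := -f) (u := -u)
    fun a ha => by simpa using hu a ha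
  have hxu : f x = u := le_antisymm (hle₁ x hx₁) (by simpa using hle₂ x hx₂)
  have hq₁ : f (x + r₁ • d) < f x := hxu ▸ hf _ hi₁
  have hd : 0 < f d := by
    simp only [map_add, map_smul, smul_eq_mul] at hq₁
    nlinarith
  have hspan : ∀ {r : ℝ} {s : Finset E}, r ≠ 0 →
      Submodule.span ℝ (insert d ((fun y => y - x) '' (s : Set E))) = ⊤ →
      Submodule.span ℝ (insert (x + r • d - x) ((fun y => y - x) '' (s : Set E))) = ⊤ := by
    intro r s hr hs
    rw [eq_top_iff, ← hs, Submodule.span_le]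
    rintro z (rfl | hz)
    · have : z = r⁻¹ • (x + r • z - x) := by simp [smul_smul, inv_mul_cancel₀ hr]
      rw [SetLike.mem_coe]
      nth_rewrite 2 [this]
      exact Submodule.smul_mem _ _ (Submodule.subset_span (Set.mem_insert _ _))
    · exact Submodule.subset_span (Set.mem_insert_of_mem _ hz)
  obtain ⟨s₁, hst₁, w₁, hw₁, hs₁, hwx₁, hsp₁⟩ := h₁.exists_weights hx₁
  obtain ⟨s₂, hst₂, w₂, hw₂, hs₂, hwx₂, hsp₂⟩ := h₂.exists_weights hx₂
  have ev₁ := eventually_mem_of_weights hK₁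
    (fun y hy => subset_convexHull ℝ _ (hst₁ hy)) hw₁ hs₁ hwx₁ (hspan hr₁.ne hsp₁) f
    (fun y hy => hxu ▸ hle₁ y hy) (interior_subset hi₁) hq₁
  have ev₂ := eventually_mem_of_weights hK₂
    (fun y hy => subset_convexHull ℝ _ (hst₂ hy)) hw₂ hs₂ hwx₂ (hspan hr₂.ne' hsp₂) (-f)
    (fun y hy => by simpa [hxu] using hle₂ y hy) (interior_subset hi₂) (by simp; positivity)
  filter_upwards [ev₁, ev₂] with y hy₁ hy₂
  rcases le_total (f y) (f x) with h | h
  · exact Or.inl (hy₁ h)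
  · exact Or.inr (hy₂ (by simpa using h))

end GenericLines

/-! ### Propagation of constants through the mesh -/

section MeshConnectivity

open Filter Topology

variable {n : ℕ} {Ω : Set (Space n)}

/-- Arbitrarily close to a boundary point there are points strictly below the graph, and these have
neighbourhoods that miss `Ω`. Slits are thereby excluded. -/
theorem IsLipschitzDomain.interior_closure (hΩ : IsLipschitzDomain Ω) :
    interior (closure Ω) = Ω := by
  refine subset_antisymm (fun x hx => ?_) hΩ.isOpen.subset_interior_closure
  by_contra hxΩ
  have hfr : x ∈ frontier Ω :=
    ⟨interior_subset hx, by rwa [hΩ.isOpen.interior_eq]⟩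
  obtain ⟨e, he, U, hU, hxU, L, γ, hγ, h⟩ := hΩ.lipschitz x hfr
  have hee : inner ℝ e e = (1 : ℝ) := by rw [real_inner_self_eq_norm_sq, he, one_pow]
  -- points below the graph
  have hge : inner ℝ e x ≤ γ (x - inner ℝ e x • e) := not_lt.1 fun hlt => hxΩ ((h x hxU).2 hlt)
  have hcont : Continuous fun r : ℝ => x - r • e := by fun_prop
  have hnear : ∀ᶠ r : ℝ in 𝓝 0, x - r • e ∈ U ∩ interior (closure Ω) := by
    refine hcont.tendsto 0 |>.eventually ?_
    simp only [zero_smul, sub_zero]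
    exact (hU.inter isOpen_interior).mem_nhds ⟨hxU, hx⟩
  obtain ⟨r, ⟨hrU, hrcl⟩, hr⟩ := ((hnear.filter_mono nhdsWithin_le_nhds).and
    (self_mem_nhdsWithin : Set.Ioi (0 : ℝ) ∈ 𝓝[>] 0)).exists
  have hr : 0 < r := hr
  have hgc : Continuous γ := hγ.continuous
  let W : Set (Space n) := U ∩ {y | inner ℝ e y < γ (y - inner ℝ e y • e)}
  have hW : IsOpen W := hU.inter (isOpen_lt (by fun_prop) (by fun_prop))
  have hmem : x - r • e ∈ W := by
    refine ⟨hrU, ?_⟩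
    have h1 : inner ℝ e (x - r • e) = inner ℝ e x - r := by
      rw [inner_sub_right, inner_smul_right, hee, mul_one]
    have h2 : x - r • e - (inner ℝ e x - r) • e = x - inner ℝ e x • e := by module
    change inner ℝ e (x - r • e) < γ _
    rw [h1, h2]
    linarith
  obtain ⟨y, hy, hyΩ⟩ := mem_closure_iff.1 (interior_subset hrcl) W hW hmem
  exact absurd ((h y hy.1).1 hyΩ) (not_lt.2 hy.2.le)

namespace PolytopalMesh

variable (M : PolytopalMesh Ω)

theorem disjoint_interior {K₁ K₂ : Set (Space n)} (h₁ : K₁ ∈ M.cells) (h₂ : K₂ ∈ M.cells)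
    (hne : K₁ ≠ K₂) : Disjoint (interior K₁) (interior K₂) := by
  rw [Set.disjoint_iff_inter_eq_empty, ← Set.not_nonempty_iff_eq_empty]
  intro h
  refine ((isOpen_interior.inter isOpen_interior).measure_pos volume h).ne' ?_
  exact measure_mono_null (Set.inter_subset_inter interior_subset interior_subset)
    (M.cell_overlap K₁ h₁ K₂ h₂ hne)

/-- A convex cell lies in the closure of its interior, so a point of `K₂` interior to `K₁` would
make the two interiors meet. -/
theorem subset_frontier_of_ne {K₁ K₂ S : Set (Space n)} (h₁ : K₁ ∈ M.cells) (h₂ : K₂ ∈ M.cells)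
    (hne : K₁ ≠ K₂) (hS₁ : S ⊆ K₁) (hS₂ : S ⊆ K₂) : S ⊆ frontier K₁ := by
  intro x hx
  refine ⟨subset_closure (hS₁ hx), fun hint => ?_⟩
  have hcl : x ∈ closure (interior K₂) := by
    rw [(M.cell_polytope K₂ h₂).convex.closure_interior_eq_closure_of_nonempty_interior
      (M.cell_interior K₂ h₂)]
    exact subset_closure (hS₂ hx)
  obtain ⟨y, hy₁, hy₂⟩ := mem_closure_iff.1 hcl _ isOpen_interior hint
  exact Set.disjoint_left.1 (M.disjoint_interior h₁ h₂ hne) hy₁ hy₂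

theorem cell_subset_closure {K : Set (Space n)} (h : K ∈ M.cells) : K ⊆ closure Ω := by
  rw [M.cell_cover]
  exact Set.subset_biUnion_of_mem (u := fun K => K) h

theorem subset_frontier_of_boundary (hΩ : IsLipschitzDomain Ω) {K S : Set (Space n)}
    (h : K ∈ M.cells) (hS : S ⊆ K ∩ frontier Ω) : S ⊆ frontier K := by
  intro x hx
  refine ⟨subset_closure (hS hx).1, fun hint => ?_⟩
  have h1 : x ∈ interior (closure Ω) := interior_mono (M.cell_subset_closure h) hint
  rw [hΩ.interior_closure] at h1
  exact (hS hx).2.2 (by rwa [hΩ.isOpen.interior_eq])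

/-- Moving from a point of a convex set towards an interior point enters the interior at once. Two
interiors reached from `x` along the same ray therefore overlap. -/
theorem exists_common_interior {K₁ K₂ : Set (Space n)} (h₁ : Convex ℝ K₁) (h₂ : Convex ℝ K₂)
    {x d : Space n} (hx₁ : x ∈ K₁) (hx₂ : x ∈ K₂) {r₁ r₂ : ℝ} (hr : 0 < r₁ * r₂)
    (hi₁ : x + r₁ • d ∈ interior K₁) (hi₂ : x + r₂ • d ∈ interior K₂) :
    ¬ Disjoint (interior K₁) (interior K₂) := by
  have hs : 0 < |r₁| + |r₂| := by
    have := abs_pos.2 (left_ne_zero_of_mul hr.ne')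
    positivity
  have ha₁ := abs_pos.2 (left_ne_zero_of_mul hr.ne')
  have ha₂ := abs_pos.2 (right_ne_zero_of_mul hr.ne')
  -- The two fractions scale `r₁` and `r₂` to the same displacement, as their signs agree.
  have m₁ := h₁.add_smul_mem_interior hx₁ hi₁ (t := |r₂| / (|r₁| + |r₂|))
    ⟨by positivity, by rw [div_le_one hs]; linarith⟩
  have m₂ := h₂.add_smul_mem_interior hx₂ hi₂ (t := |r₁| / (|r₁| + |r₂|))
    ⟨by positivity, by rw [div_le_one hs]; linarith⟩
  have heq : |r₁| / (|r₁| + |r₂|) * r₂ = |r₂| / (|r₁| + |r₂|) * r₁ := by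
    have : |r₁| * r₂ = |r₂| * r₁ := by
      rcases pos_and_pos_or_neg_and_neg_of_mul_pos hr with ⟨h1, h2⟩ | ⟨h1, h2⟩
      · rw [abs_of_pos h1, abs_of_pos h2, mul_comm]
      · rw [abs_of_neg h1, abs_of_neg h2]; ring
    rw [div_mul_eq_mul_div, div_mul_eq_mul_div, this]
  rw [smul_smul] at m₁ m₂
  rw [heq] at m₂
  exact fun hd => Set.disjoint_left.1 hd m₁ m₂

/-- Piecewise constants without jumps across the interior sides and with zero values at the boundary
sides vanish. -/
theorem eq_zero_of_no_jumps (hn : 0 < n) (hΩ : IsLipschitzDomain Ω) (c : Set (Space n) → ℝ)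
    (hint : ∀ S ∈ M.sides, ∀ K₁ ∈ M.cells, ∀ K₂ ∈ M.cells, K₁ ≠ K₂ → S ⊆ K₁ ∩ K₂ → c K₁ = c K₂)
    (hbdry : ∀ S ∈ M.sides, ∀ K ∈ M.cells, S ⊆ K ∩ frontier Ω → c K = 0) :
    ∀ K ∈ M.cells, c K = 0 := by
  intro K₀ hK₀
  by_contra hc
  let d : Space n := EuclideanSpace.single ⟨0, hn⟩ 1
  have hd : d ≠ 0 := by simp [d]
  choose! t ht using M.cell_polytope
  -- One base point is chosen generic for the vertices of all cells together, so the line is generic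
  -- for every cell.
  obtain ⟨p, hpK₀, hgen⟩ := exists_isGeneric (M.cells.biUnion t) d
    (isOpen_interior (s := K₀)) (M.cell_interior K₀ hK₀)
  have hgen' : ∀ K ∈ M.cells, ∀ r : ℝ, IsGeneric (t K) d (p + r • d) := fun K hK r =>
    (hgen.mono (Finset.subset_biUnion_of_mem t hK)).add_smul r
  have hconv : ∀ K ∈ M.cells, Convex ℝ K := fun K hK => (M.cell_polytope K hK).convex
  have hmeet : ∀ K ∈ M.cells, ∀ r : ℝ, p + r • d ∈ K → ∃ r' : ℝ, p + r • d + r' • d ∈ interior K := by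
    intro K hK r hr
    have h1 := M.cell_interior K hK
    have h2 := hgen' K hK r
    rw [ht K hK] at hr h1 ⊢
    exact h2.exists_mem_interior hr h1
  -- A cell is determined by a point `x` of the line and the direction in which the line runs from
  -- `x` into its interior.
  have hsame : ∀ K₁ ∈ M.cells, ∀ K₂ ∈ M.cells, ∀ x ∈ K₁, x ∈ K₂ → ∀ r₁ r₂ : ℝ, 0 < r₁ * r₂ →
      x + r₁ • d ∈ interior K₁ → x + r₂ • d ∈ interior K₂ → K₁ = K₂ := by
    intro K₁ h₁ K₂ h₂ x hx₁ hx₂ r₁ r₂ hr hi₁ hi₂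
    by_contra hne
    exact exists_common_interior (hconv K₁ h₁) (hconv K₂ h₂) hx₁ hx₂ hr hi₁ hi₂
      (M.disjoint_interior h₁ h₂ hne)
  -- the last point of the line in the cells with the value `c K₀`
  let A := M.cells.filter fun K => c K = c K₀
  have hU : IsCompact (⋃ K ∈ A, K) := A.isCompact_biUnion fun K hK =>
    (M.cell_polytope K (Finset.mem_filter.1 hK).1).isCompact
  have hemb : Topology.IsClosedEmbedding fun r : ℝ => p + r • d :=
    (Homeomorph.addLeft p).isClosedEmbedding.comp (isClosedEmbedding_smul_left hd)
  have hR := hemb.isCompact_preimage hU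
  have hne : ((fun r : ℝ => p + r • d) ⁻¹' (⋃ K ∈ A, K)).Nonempty := by
    refine ⟨0, ?_⟩
    simp only [Set.mem_preimage, zero_smul, add_zero, Set.mem_iUnion]
    exact ⟨K₀, Finset.mem_filter.2 ⟨hK₀, rfl⟩, interior_subset hpK₀⟩
  obtain ⟨R, hRmem, hRmax⟩ := hR.exists_isGreatest hne
  set x := p + R • d with hx
  have hlast : ∀ K ∈ A, ∀ r > (0 : ℝ), x + r • d ∉ K := by
    intro K hK r hr hmem
    have : R + r ≤ R := hRmax (by
      simp only [Set.mem_preimage, Set.mem_iUnion]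
      exact ⟨K, hK, by rwa [add_smul, ← add_assoc]⟩)
    linarith
  simp only [Set.mem_preimage, Set.mem_iUnion] at hRmem
  obtain ⟨K, hKA, hxK⟩ := hRmem
  have hK := (Finset.mem_filter.1 hKA).1
  have hcK := (Finset.mem_filter.1 hKA).2
  have hxfr : x ∈ frontier K := by
    refine ⟨subset_closure hxK, fun hint => ?_⟩
    have hcont : Continuous fun r : ℝ => x + r • d := by fun_prop
    have hev : ∀ᶠ r : ℝ in 𝓝 0, x + r • d ∈ interior K := by
      refine (hcont.tendsto 0).eventually ?_
      simpa using isOpen_interior.mem_nhds hint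
    obtain ⟨r, hr, hr0⟩ := ((hev.filter_mono nhdsWithin_le_nhds).and
      (self_mem_nhdsWithin : Set.Ioi (0 : ℝ) ∈ 𝓝[>] 0)).exists
    exact hlast K hKA r hr0 (interior_subset hr)
  obtain ⟨r, hr⟩ := hmeet K hK R hxK
  have hsign : ∀ K' ∈ M.cells, ∀ r' : ℝ, x ∈ frontier K' → x + r' • d ∈ interior K' → r' ≠ 0 := by
    rintro K' _ r' hfr hi rfl
    rw [zero_smul, add_zero] at hi
    exact hfr.2 hi
  -- The interior of `K` lies behind `x` on the line, since nothing ahead of `x` belongs to a cell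
  -- of `A`.
  have hr0 : r < 0 := lt_of_le_of_ne
    (not_lt.1 fun hpos => hlast K hKA r hpos (interior_subset hr)) (hsign K hK r hxfr hr)
  have hxS : x ∈ ⋃ S ∈ M.sides, S := by
    rw [← M.side_cover]
    exact Set.mem_biUnion hK hxfr
  simp only [Set.mem_iUnion] at hxS
  obtain ⟨S, hS, hxS⟩ := hxS
  rcases (M.side_isSide S hS).interior_or_boundary with
    ⟨K₁, h₁, K₂, h₂, hne, hsub⟩ | ⟨K₁, h₁, hsub⟩
  · have hS₁ := M.subset_frontier_of_ne h₁ h₂ hne (fun y hy => (hsub hy).1) fun y hy => (hsub hy).2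
    have hS₂ := M.subset_frontier_of_ne h₂ h₁ hne.symm (fun y hy => (hsub hy).2)
      fun y hy => (hsub hy).1
    obtain ⟨r₁, hr₁⟩ := hmeet K₁ h₁ R (hsub hxS).1
    obtain ⟨r₂, hr₂⟩ := hmeet K₂ h₂ R (hsub hxS).2
    have hs₁ := hsign K₁ h₁ r₁ (hS₁ hxS) hr₁
    have hs₂ := hsign K₂ h₂ r₂ (hS₂ hxS) hr₂
    have hcc := hint S hS K₁ h₁ K₂ h₂ hne hsub
    -- The cells of the side lie ahead of and behind `x`. The one behind must be `K`, although `K`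
    -- was not known to contain the side; the one ahead shares its value and contradicts `hlast`.
    have hopp : r₁ * r₂ < 0 := lt_of_le_of_ne (not_lt.1 fun hpos =>
      hne (hsame K₁ h₁ K₂ h₂ x (hsub hxS).1 (hsub hxS).2 r₁ r₂ hpos hr₁ hr₂)) (mul_ne_zero hs₁ hs₂)
    rcases lt_or_gt_of_ne hs₁ with hneg | hpos
    · have hKK₁ := hsame K hK K₁ h₁ x hxK (hsub hxS).1 r r₁ (mul_pos_of_neg_of_neg hr0 hneg) hr hr₁
      have hA₂ : K₂ ∈ A := Finset.mem_filter.2 ⟨h₂, by rw [← hcc, ← hKK₁, hcK]⟩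
      exact hlast K₂ hA₂ r₂ (by nlinarith) (interior_subset hr₂)
    · have hKK₂ := hsame K hK K₂ h₂ x hxK (hsub hxS).2 r r₂
        (mul_pos_of_neg_of_neg hr0 (by nlinarith)) hr hr₂
      have hA₁ : K₁ ∈ A := Finset.mem_filter.2 ⟨h₁, by rw [hcc, ← hKK₂, hcK]⟩
      exact hlast K₁ hA₁ r₁ hpos (interior_subset hr₁)
  · have hS₁ := M.subset_frontier_of_boundary hΩ h₁ hsub
    obtain ⟨r₁, hr₁⟩ := hmeet K₁ h₁ R (hsub hxS).1
    have hs₁ := hsign K₁ h₁ r₁ (hS₁ hxS) hr₁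
    have hc₁ := hbdry S hS K₁ h₁ hsub
    -- If the cell of the boundary side lies behind `x`, it is `K`, whose value would be zero. If it
    -- lies ahead, it forms with `K` a neighbourhood of `x` inside `closure Ω`.
    rcases lt_or_gt_of_ne hs₁ with hneg | hpos
    · have hKK₁ := hsame K hK K₁ h₁ x hxK (hsub hxS).1 r r₁ (mul_pos_of_neg_of_neg hr0 hneg) hr hr₁
      exact hc (by rw [← hcK, hKK₁, hc₁])
    · have hne : K ≠ K₁ := by
        rintro rfl
        exact hlast K hKA r₁ hpos (interior_subset hr₁)
      have hdisj := M.disjoint_interior hK h₁ hne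
      have hx₁ := (hsub hxS).1
      have hsubU : K ∪ K₁ ⊆ closure Ω :=
        Set.union_subset (M.cell_subset_closure hK) (M.cell_subset_closure h₁)
      have hnhds : K ∪ K₁ ∈ 𝓝 x := by
        have hg := hgen' K hK R
        have hg₁ := hgen' K₁ h₁ R
        rw [ht K hK] at hxK hr hdisj ⊢
        rw [ht K₁ h₁] at hx₁ hr₁ hdisj ⊢
        exact hg.union_mem_nhds hg₁ hxK hx₁ hr0 hpos hr hr₁ hdisj
      have hxint : x ∈ interior (closure Ω) :=
        mem_interior_iff_mem_nhds.2 (mem_of_superset hnhds hsubU)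
      rw [hΩ.interior_closure] at hxint
      exact (hsub hxS).2.2 (by rwa [hΩ.isOpen.interior_eq])

end PolytopalMesh

end MeshConnectivity

/-! ### Surface integrals, projections and weights on sides -/

section Sides

open Filter Topology

variable {n : ℕ}

/-- An isometric parametrization of a hyperplane. -/
theorem exists_hyperplane_isometry (ν x₀ : Space n) (hν : ν ≠ 0) :
    ∃ φ : EuclideanSpace ℝ (Fin (n - 1)) →ᵃⁱ[ℝ] Space n,
      ∀ x, x ∈ Set.range φ ↔ inner ℝ ν x = inner ℝ ν x₀ := by
  let W : Submodule ℝ (Space n) := (Submodule.span ℝ {ν})ᗮ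
  have hW : Module.finrank ℝ W = n - 1 := by
    have h1 := Submodule.finrank_add_finrank_orthogonal (Submodule.span ℝ {ν})
    rw [finrank_span_singleton hν, finrank_euclideanSpace_fin] at h1
    change Module.finrank ℝ (Submodule.span ℝ {ν})ᗮ = n - 1
    omega
  let e := ((stdOrthonormalBasis ℝ W).reindex (finCongr hW)).repr.symm
  let ψ : EuclideanSpace ℝ (Fin (n - 1)) →ₗᵢ[ℝ] Space n :=
    W.subtypeₗᵢ.comp e.toLinearIsometry
  refine ⟨(AffineIsometryEquiv.constVAdd ℝ (Space n) x₀).toAffineIsometry.comp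
    ψ.toAffineIsometry, fun x => ?_⟩
  have hφ : ∀ z, (AffineIsometryEquiv.constVAdd ℝ (Space n) x₀).toAffineIsometry.comp
    ψ.toAffineIsometry z = x₀ + (e z : Space n) := fun z => rfl
  constructor
  · rintro ⟨z, rfl⟩
    rw [hφ, inner_add_right, Submodule.mem_orthogonal_singleton_iff_inner_right.1 (e z).2, add_zero]
  · intro hx
    have hmem : x - x₀ ∈ W := by
      rw [Submodule.mem_orthogonal_singleton_iff_inner_right, inner_sub_right, hx, sub_self]
    refine ⟨e.symm ⟨x - x₀, hmem⟩, ?_⟩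
    rw [hφ, LinearIsometryEquiv.apply_symm_apply]
    simp

theorem surfaceMeasure_image (φ : EuclideanSpace ℝ (Fin (n - 1)) →ᵃⁱ[ℝ] Space n)
    (T : Set (EuclideanSpace ℝ (Fin (n - 1)))) : surfaceMeasure n (φ '' T) = volume T := by
  rw [surfaceMeasure, φ.isometry.euclideanHausdorffMeasure_image,
    EuclideanSpace.euclideanHausdorffMeasure_eq_volume]

theorem surfaceMeasure_eq_volume_preimage (φ : EuclideanSpace ℝ (Fin (n - 1)) →ᵃⁱ[ℝ] Space n)
    {S : Set (Space n)} (hS : S ⊆ Set.range φ) : surfaceMeasure n S = volume (φ ⁻¹' S) := by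
  rw [← surfaceMeasure_image, Set.image_preimage_eq_of_subset hS]

theorem IsPolyhedralSet.isCompact {S : Set (Space n)} (h : IsPolyhedralSet S) : IsCompact S := by
  obtain ⟨F, hF, hP, rfl⟩ := h
  exact hF.isCompact_sUnion fun P hPF => (hP P hPF).isCompact

variable {Ω : Set (Space n)} {cells : Finset (Set (Space n))} {S : Set (Space n)}

theorem IsSide.isCompact (h : IsSide Ω cells S) : IsCompact S := h.polyhedral.isCompact

/-- Transfers questions about surface measure to Lebesgue measure in dimension `n - 1`. -/
theorem IsSide.exists_isometry (h : IsSide Ω cells S) :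
    ∃ (ν : Space n) (c : ℝ) (φ : EuclideanSpace ℝ (Fin (n - 1)) →ᵃⁱ[ℝ] Space n), S ⊆ Set.range φ ∧
      ∀ x, x ∈ Set.range φ ↔ inner ℝ ν x = c := by
  obtain ⟨ν, c, hν, hS⟩ := h.hyperplane
  obtain ⟨x₀, hx₀⟩ := h.connected.nonempty
  obtain ⟨φ, hφ⟩ := exists_hyperplane_isometry ν x₀ hν
  rw [hS x₀ hx₀] at hφ
  exact ⟨ν, c, φ, fun x hx => (hφ x).2 (hS x hx), hφ⟩

theorem IsSide.measure_lt_top (h : IsSide Ω cells S) : surfaceMeasure n S < ⊤ := by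
  obtain ⟨ν, c, φ, hS, -⟩ := h.exists_isometry
  rw [surfaceMeasure_eq_volume_preimage φ hS]
  exact (φ.isometry.isClosedEmbedding.isCompact_preimage h.isCompact).measure_lt_top

/-- A set of positive surface measure in a hyperplane spans this hyperplane. -/
theorem affineSpan_preimage_eq_top {φ : EuclideanSpace ℝ (Fin (n - 1)) →ᵃⁱ[ℝ] Space n}
    (hS : S ⊆ Set.range φ) (hpos : 0 < surfaceMeasure n S) : affineSpan ℝ (φ ⁻¹' S) = ⊤ := by
  by_contra hcon
  rw [surfaceMeasure_eq_volume_preimage φ hS] at hpos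
  exact hpos.ne' (measure_mono_null (subset_affineSpan ℝ _)
    (Measure.addHaar_affineSubspace volume _ hcon))

theorem analyticOnNhd_polyEval_comp (φ : EuclideanSpace ℝ (Fin (n - 1)) →ᵃⁱ[ℝ] Space n)
    (p : MvPolynomial (Fin n) ℝ) : AnalyticOnNhd ℝ (fun z => polyEval p (φ z)) Set.univ := by
  intro z _
  have hφ : AnalyticAt ℝ (fun z => φ z) z := by
    have : ∀ z, φ z = φ.linearIsometry.toContinuousLinearMap z + φ 0 := fun z => by
      have := φ.map_vadd 0 z
      simpa using this
    rw [show (fun z => φ z) = fun z => φ.linearIsometry.toContinuousLinearMap z + φ 0 from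
      funext this]
    exact (φ.linearIsometry.toContinuousLinearMap.analyticAt z).fun_add analyticAt_const
  have h2 : AnalyticAt ℝ (fun z => fun i => φ z i) z := by
    rw [analyticAt_pi_iff]
    intro i
    exact ((EuclideanSpace.proj (𝕜 := ℝ) i).analyticAt _).comp hφ
  exact AnalyticAt.fun_comp (g := fun x : Fin n → ℝ => MvPolynomial.eval x p)
    (AnalyticOnNhd.eval_mvPolynomial p _ (Set.mem_univ _)) h2

/-- A polynomial that vanishes almost everywhere on a side vanishes on its hyperplane. -/
theorem IsSide.polyEval_eq_zero (h : IsSide Ω cells S) {p : MvPolynomial (Fin n) ℝ}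
    (hp : surfaceMeasure n {x ∈ S | polyEval p x ≠ 0} = 0) : ∀ x ∈ S, polyEval p x = 0 := by
  obtain ⟨ν, c, φ, hS, -⟩ := h.exists_isometry
  obtain ⟨F, hF, hP, rfl⟩ := h.polyhedral
  -- A side need not be convex, but one of its finitely many convex pieces has positive measure and
  -- hence interior points in the hyperplane. Analyticity extends the vanishing from there to the
  -- whole hyperplane.
  obtain ⟨P, hPF, hPpos⟩ : ∃ P ∈ F, 0 < surfaceMeasure n P := by
    by_contra! hcon
    exact h.measure_pos.ne' ((measure_sUnion_null_iff hF.countable).2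
      fun P hPF => le_antisymm (hcon P hPF) zero_le)
  have hPS : P ⊆ ⋃₀ F := Set.subset_sUnion_of_mem hPF
  have hspan := affineSpan_preimage_eq_top (hPS.trans hS) hPpos
  have hconv : Convex ℝ (φ ⁻¹' P) := (hP P hPF).convex.affine_preimage φ.toAffineMap
  obtain ⟨z₀, hz₀⟩ := hconv.interior_nonempty_iff_affineSpan_eq_top.2 hspan
  have hcont : Continuous fun z => polyEval p (φ z) := (continuous_polyEval p).comp φ.continuous
  have hae : (fun z => polyEval p (φ z)) =ᵐ[volume.restrict (interior (φ ⁻¹' P))] fun _ => 0 := by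
    rw [Filter.EventuallyEq, ae_restrict_iff' isOpen_interior.measurableSet, ae_iff]
    rw [surfaceMeasure_eq_volume_preimage φ fun x hx => hS hx.1] at hp
    refine measure_mono_null (fun z hz => ?_) hp
    simp only [Classical.not_imp, Set.mem_ofPred_eq] at hz
    exact ⟨hPS (interior_subset hz.1 : z ∈ φ ⁻¹' P), hz.2⟩
  have heq := Measure.eqOn_open_of_ae_eq hae isOpen_interior hcont.continuousOn continuousOn_const
  have hzero := (analyticOnNhd_polyEval_comp φ p).eqOn_zero_of_preconnected_of_eventuallyEq_zero
    isPreconnected_univ (Set.mem_univ z₀)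
    (Filter.mem_of_superset (isOpen_interior.mem_nhds hz₀) fun z hz => heq hz)
  intro x hx
  obtain ⟨z, rfl⟩ := hS hx
  exact hzero (Set.mem_univ z)

theorem continuous_of_mem_sidePoly {m : ℕ} {f : S → ℝ} (hf : f ∈ sidePoly m S) :
    Continuous f := by
  obtain ⟨p, -, rfl⟩ := hf
  exact (continuous_polyEval p).comp continuous_subtype_val

theorem sideInner_comm (f g : S → ℝ) : sideInner f g = sideInner g f := by
  simp only [sideInner, mul_comm]

theorem sideInner_smul_left (c : ℝ) (f g : S → ℝ) :
    sideInner (fun x => c * f x) g = c * sideInner f g := by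
  simp only [sideInner, mul_assoc]
  exact integral_const_mul _ _

theorem sideInner_smul_right (c : ℝ) (f g : S → ℝ) :
    sideInner f (fun x => c * g x) = c * sideInner f g := by
  rw [sideInner_comm, sideInner_smul_left, sideInner_comm]

theorem sideInner_zero_left (g : S → ℝ) : sideInner 0 g = 0 := by
  simp [sideInner]

theorem sideInner_self_nonneg (f : S → ℝ) : 0 ≤ sideInner f f :=
  integral_nonneg fun x => mul_self_nonneg (f x)

theorem IsSide.comap_apply (h : IsSide Ω cells S) (A : Set S) :
    (surfaceMeasure n).comap Subtype.val A = surfaceMeasure n (Subtype.val '' A) :=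
  (MeasurableEmbedding.subtype_coe h.isCompact.measurableSet).comap_apply _ _

theorem IsSide.integrable (h : IsSide Ω cells S) {f : S → ℝ} (hf : Continuous f) :
    Integrable f ((surfaceMeasure n).comap Subtype.val) := by
  have : CompactSpace S := isCompact_iff_compactSpace.1 h.isCompact
  have : IsFiniteMeasure ((surfaceMeasure n).comap (Subtype.val : S → Space n)) := ⟨by
    rw [h.comap_apply, Subtype.coe_image_univ]
    exact h.measure_lt_top⟩
  exact hf.integrable_of_hasCompactSupport (HasCompactSupport.of_compactSpace f)

theorem IsSide.sideInner_add_left (h : IsSide Ω cells S) {f₁ f₂ g : S → ℝ} (h₁ : Continuous f₁)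
    (h₂ : Continuous f₂) (hg : Continuous g) :
    sideInner (fun x => f₁ x + f₂ x) g = sideInner f₁ g + sideInner f₂ g := by
  simp only [sideInner, add_mul]
  exact integral_add (h.integrable (h₁.mul hg)) (h.integrable (h₂.mul hg))

theorem IsSide.sideInner_add_right (h : IsSide Ω cells S) {f g₁ g₂ : S → ℝ} (hf : Continuous f)
    (h₁ : Continuous g₁) (h₂ : Continuous g₂) :
    sideInner f (fun x => g₁ x + g₂ x) = sideInner f g₁ + sideInner f g₂ := by
  rw [sideInner_comm, h.sideInner_add_left h₁ h₂ hf, sideInner_comm, sideInner_comm g₂]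

theorem IsSide.eq_zero_of_sideInner_self_eq_zero (h : IsSide Ω cells S) {m : ℕ} {f : S → ℝ}
    (hf : f ∈ sidePoly m S) (h0 : sideInner f f = 0) : f = 0 := by
  have hcont := continuous_of_mem_sidePoly hf
  obtain ⟨p, -, rfl⟩ := hf
  have h1 := (integral_eq_zero_iff_of_nonneg (fun x => mul_self_nonneg _)
    (h.integrable (hcont.mul hcont))).1 h0
  rw [Filter.EventuallyEq, ae_iff, h.comap_apply] at h1
  have h2 := h.polyEval_eq_zero (p := p) (measure_mono_null (fun x hx => ?_) h1)
  · funext x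
    exact h2 x x.2
  · refine ⟨⟨x, hx.1⟩, ?_, rfl⟩
    simpa [polyRestrict] using hx.2

instance (m : ℕ) (S : Set (Space n)) : Module.Finite ℝ (sidePoly m S) :=
  Module.Finite.map _ _

/-- The `L²` form is definite on the finite-dimensional space of traces, so the functional
`sideInner f` has a representative there. -/
theorem IsSide.exists_sideProj (h : IsSide Ω cells S) (m : ℕ) {f : S → ℝ} (hf : Continuous f) :
    ∃ p, p ∈ sidePoly m S ∧ ∀ q ∈ sidePoly m S, sideInner p q = sideInner f q := by
  let B : LinearMap.BilinForm ℝ (sidePoly m S) := LinearMap.mk₂ ℝ (fun p q => sideInner p.1 q.1)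
    (fun p₁ p₂ q => h.sideInner_add_left (continuous_of_mem_sidePoly p₁.2)
      (continuous_of_mem_sidePoly p₂.2) (continuous_of_mem_sidePoly q.2))
    (fun c p q => sideInner_smul_left c p.1 q.1)
    (fun p q₁ q₂ => h.sideInner_add_right (continuous_of_mem_sidePoly p.2)
      (continuous_of_mem_sidePoly q₁.2) (continuous_of_mem_sidePoly q₂.2))
    (fun c p q => sideInner_smul_right c p.1 q.1)
  have hB : ∀ p q, B p q = sideInner p.1 q.1 := fun _ _ => rfl
  let F : Module.Dual ℝ (sidePoly m S) :=
    { toFun := fun q => sideInner f q.1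
      map_add' := fun q₁ q₂ => h.sideInner_add_right hf
        (continuous_of_mem_sidePoly q₁.2) (continuous_of_mem_sidePoly q₂.2)
      map_smul' := fun c q => sideInner_smul_right c f q.1 }
  obtain ⟨p, hp⟩ := (bijective_of_posDef B fun p hp =>
    Subtype.ext (h.eq_zero_of_sideInner_self_eq_zero p.2 hp)).2 F
  exact ⟨p.1, p.2, fun q hq => by rw [← hB p ⟨q, hq⟩, hp]; rfl⟩

theorem IsSide.sideProj_mem (h : IsSide Ω cells S) (m : ℕ) {f : S → ℝ} (hf : Continuous f) :
    sideProj m f ∈ sidePoly m S :=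
  (Classical.epsilon_spec (h.exists_sideProj m hf)).1

theorem IsSide.sideInner_sideProj (h : IsSide Ω cells S) {m : ℕ} {f : S → ℝ} (hf : Continuous f)
    {q : S → ℝ} (hq : q ∈ sidePoly m S) : sideInner (sideProj m f) q = sideInner f q :=
  (Classical.epsilon_spec (h.exists_sideProj m hf)).2 q hq

/-- The projection is symmetric. -/
theorem IsSide.sideInner_sideProj_comm (h : IsSide Ω cells S) (m : ℕ) {f g : S → ℝ}
    (hf : Continuous f) (hg : Continuous g) :
    sideInner (sideProj m f) g = sideInner (sideProj m g) f := by
  rw [sideInner_comm, ← h.sideInner_sideProj hg (h.sideProj_mem m hf), sideInner_comm,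
    h.sideInner_sideProj hf (h.sideProj_mem m hg), sideInner_comm]

theorem IsSide.sideInner_sideProj_self (h : IsSide Ω cells S) (m : ℕ) {f : S → ℝ}
    (hf : Continuous f) :
    sideInner (sideProj m f) f = sideInner (sideProj m f) (sideProj m f) := by
  rw [h.sideInner_sideProj hf (h.sideProj_mem m hf), sideInner_comm]

/-- The projection is the identity on polynomials. -/
theorem IsSide.eq_zero_of_sideProj_eq_zero (h : IsSide Ω cells S) {m : ℕ} {f : S → ℝ}
    (hf : f ∈ sidePoly m S) (h0 : sideProj m f = 0) : f = 0 := by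
  refine h.eq_zero_of_sideInner_self_eq_zero hf ?_
  rw [← h.sideInner_sideProj (continuous_of_mem_sidePoly hf) hf, h0, sideInner_zero_left]

/-- The hyperplane of a side in the boundary of a convex set does not meet its interior. -/
theorem disjoint_interior_range (h : IsSide Ω cells S) {K : Set (Space n)}
    {φ : EuclideanSpace ℝ (Fin (n - 1)) →ᵃⁱ[ℝ] Space n} (hS : S ⊆ Set.range φ)
    (hK : Convex ℝ K) (hSK : S ⊆ K) (hfr : S ⊆ frontier K) :
    Disjoint (interior K) (Set.range φ) := by
  rw [Set.disjoint_right]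
  rintro _ ⟨z₀, rfl⟩ hz₀
  have hconv : Convex ℝ (φ ⁻¹' K) := hK.affine_preimage φ.toAffineMap
  have hpos := h.measure_pos
  rw [surfaceMeasure_eq_volume_preimage φ hS] at hpos
  -- If the hyperplane met the interior, every point of the side would lie on the relative frontier
  -- of the convex section of `K`, which is a null set.
  refine hpos.ne' (measure_mono_null (fun z hz => ?_) (hconv.addHaar_frontier volume))
  refine ⟨subset_closure (hSK hz), fun hint => ?_⟩
  have hcont : Continuous fun r : ℝ => AffineMap.lineMap z₀ z r := AffineMap.lineMap_continuous
  have hev : ∀ᶠ r : ℝ in 𝓝 1, AffineMap.lineMap z₀ z r ∈ φ ⁻¹' K := by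
    refine (hcont.tendsto 1).eventually ?_
    rw [AffineMap.lineMap_apply_one]
    exact mem_interior_iff_mem_nhds.1 hint
  obtain ⟨r, hr, hr1⟩ := ((hev.filter_mono nhdsWithin_le_nhds).and
    (self_mem_nhdsWithin : Set.Ioi (1 : ℝ) ∈ 𝓝[>] 1)).exists
  have hr1 : 1 < r := hr1
  have hr0 : 0 < r := by linarith
  refine (hfr hz).2 (hK.openSegment_interior_self_subset_interior hz₀ hr ?_)
  -- These weights express `φ z` through the interior point `φ z₀` and the point of `K` slightly
  -- beyond `φ z`.
  refine ⟨1 - r⁻¹, r⁻¹, sub_pos.2 (inv_lt_one_of_one_lt₀ hr1), inv_pos.2 hr0, by ring, ?_⟩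
  have h1 : φ (AffineMap.lineMap z₀ z r) = AffineMap.lineMap (φ z₀) (φ z) r :=
    φ.toAffineMap.apply_lineMap z₀ z r
  rw [h1, AffineMap.lineMap_apply_module, smul_add, smul_smul, smul_smul, inv_mul_cancel₀ hr0.ne',
    one_smul, ← add_assoc, ← add_smul]
  have : 1 - r⁻¹ + r⁻¹ * (1 - r) = 0 := by field_simp; ring
  rw [this, zero_smul, zero_add]

/-- The average over a compact convex set is not separated from its interior. -/
theorem apply_average_lt {K : Set (Space n)} (hK : IsCompact K) (hconv : Convex ℝ K)
    (hne : (interior K).Nonempty) {g : StrongDual ℝ (Space n)} {u : ℝ}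
    (hg : ∀ a ∈ interior K, g a < u) : g (⨍ x in K, x) < u := by
  have hle := le_of_forall_interior hconv hne fun a ha => (hg a ha).le
  have hvol : 0 < volume.real K :=
    ENNReal.toReal_pos ((isOpen_interior.measure_pos volume hne).trans_le
      (measure_mono interior_subset)).ne' hK.measure_lt_top.ne
  have hint : ∫ x in K, g x = volume.real K * g (⨍ x in K, x) := by
    rw [setAverage_eq, map_smul, smul_eq_mul, mul_inv_cancel_left₀ hvol.ne',
      ← g.integral_comp_comm (φ := fun x => x) (continuousOn_id.integrableOn_compact hK)]
  -- On `K` the truncation changes nothing; it provides a function that is nonnegative on the whole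
  -- space.
  have hsub : ∫ x in K, max (u - g x) 0 = volume.real K * (u - g (⨍ x in K, x)) := by
    rw [setIntegral_congr_fun (g := fun x => u - g x) hK.measurableSet
      fun x hx => max_eq_left (sub_nonneg.2 (hle x hx)),
      integral_sub (continuousOn_const.integrableOn_compact hK)
        (g.continuous.continuousOn.integrableOn_compact hK), hint, setIntegral_const, smul_eq_mul]
    ring
  have hnn : 0 ≤ ∫ x in K, max (u - g x) 0 := integral_nonneg fun x => le_max_right _ _
  have hne0 : ∫ x in K, max (u - g x) 0 ≠ 0 := fun h0 => by
    obtain ⟨a, ha⟩ := hne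
    have := eq_zero_of_setIntegral_eq_zero hK (f := fun x => max (u - g x) 0) (by fun_prop)
      (fun x => le_max_right _ _) h0 a ha
    have h2 := le_max_left (u - g a) 0
    have := hg a ha
    linarith
  have hpos := lt_of_le_of_ne hnn hne0.symm
  rw [hsub] at hpos
  have := pos_of_mul_pos_right hpos hvol.le
  linarith

theorem diam_pos_of_interior_nonempty (hn : 0 < n) {K : Set (Space n)} (hK : IsCompact K)
    (hne : (interior K).Nonempty) : 0 < Metric.diam K := by
  have : Nonempty (Fin n) := ⟨⟨0, hn⟩⟩
  refine Metric.diam_pos ?_ hK.isBounded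
  by_contra hsub
  rw [Set.not_nontrivial_iff] at hsub
  exact (isOpen_interior.measure_pos volume hne).ne'
    (measure_mono_null interior_subset (hsub.measure_zero volume))

/-- The critical factor is the volume of the hull. The barycenter is off the hyperplane of the side,
which is separated from the interior of `K`, and the side spans that hyperplane; together they span
the space affinely. -/
theorem IsSide.weight_pos (hn : 0 < n) (h : IsSide Ω cells S) {K : Set (Space n)}
    (hK : IsConvexPolytope K) (hne : (interior K).Nonempty) (hfr : S ⊆ frontier K) :
    0 < weight S K := by
  have hcomp := hK.isCompact
  have hSK : S ⊆ K := hfr.trans hcomp.isClosed.frontier_subset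
  have hS : 0 < (surfaceMeasure n).real S :=
    ENNReal.toReal_pos h.measure_pos.ne' h.measure_lt_top.ne
  have hdiam := diam_pos_of_interior_nonempty hn hcomp hne
  have hvol : 0 < volume.real (convexHull ℝ (insert (⨍ x in K, x) S)) := by
    have hbdd : Bornology.IsBounded (convexHull ℝ (insert (⨍ x in K, x) S)) :=
      isBounded_convexHull.2 (h.isCompact.insert _).isBounded
    refine ENNReal.toReal_pos ?_ hbdd.measure_lt_top.ne
    have hint : (interior (convexHull ℝ (insert (⨍ x in K, x) S))).Nonempty := by
      rw [interior_convexHull_nonempty_iff_affineSpan_eq_top]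
      obtain ⟨ν, c, φ, hSφ, hφ⟩ := h.exists_isometry
      have hHconv : Convex ℝ (Set.range φ) := by
        rw [← Set.image_univ]
        exact convex_univ.affine_image φ.toAffineMap
      obtain ⟨g, u, hg, hu⟩ := geometric_hahn_banach_open hK.convex.interior isOpen_interior
        hHconv (disjoint_interior_range h hSφ hK.convex hSK hfr)
      have hb : (⨍ x in K, x) ∉ Set.range φ := fun hb =>
        absurd (apply_average_lt hcomp hK.convex hne hg) (not_lt.2 (hu _ hb))
      generalize (⨍ x in K, x) = b at hb
      rw [hφ] at hb
      have hrange : Set.range φ ⊆ affineSpan ℝ (insert b S) := by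
        rintro _ ⟨z, rfl⟩
        have hz : z ∈ affineSpan ℝ (φ ⁻¹' S) := by
          rw [affineSpan_preimage_eq_top hSφ h.measure_pos]
          exact AffineSubspace.mem_top _ _ _
        have hz' : φ.toAffineMap z ∈ (affineSpan ℝ (φ ⁻¹' S)).map φ.toAffineMap :=
          AffineSubspace.mem_map_of_mem _ hz
        rw [AffineSubspace.map_span] at hz'
        refine affineSpan_mono ℝ ?_ hz'
        exact (Set.image_preimage_subset φ S).trans (Set.subset_insert _ _)
      obtain ⟨x₀, hx₀⟩ := h.connected.nonempty
      have hx₀c : inner ℝ ν x₀ = c := (hφ x₀).1 (hSφ hx₀)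
      rw [eq_top_iff]
      intro y _
      -- Subtracting `α • (b - x₀)` moves `y` into the hyperplane of the side.
      set α := (inner ℝ ν y - c) / (inner ℝ ν b - c) with hα
      have hx₁ : y - α • (b - x₀) ∈ Set.range φ := by
        rw [hφ, inner_sub_right, inner_smul_right, inner_sub_right, hx₀c, hα,
          div_mul_cancel₀ _ (sub_ne_zero.2 hb)]
        ring
      have := (affineSpan ℝ (insert b S)).smul_vsub_vadd_mem α
        (subset_affineSpan ℝ _ (Set.mem_insert b S))
        (subset_affineSpan ℝ _ (Set.mem_insert_of_mem b hx₀)) (hrange hx₁)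
      simpa using this
    exact ((isOpen_interior.measure_pos volume hint).trans_le (measure_mono interior_subset)).ne'
  unfold weight
  positivity

end Sides

/-! ### The potential reconstruction -/

namespace PolytopalMesh

variable {n : ℕ} {Ω : Set (Space n)} (M : PolytopalMesh Ω)

theorem isCompact_cell (K : M.cells) : IsCompact K.1 := (M.cell_polytope K.1 K.2).isCompact

theorem interior_cell (K : M.cells) : (interior K.1).Nonempty := M.cell_interior K.1 K.2

theorem isSide (S : M.sides) : IsSide Ω M.cells S.1 := M.side_isSide S.1 S.2

theorem volume_cell_pos (K : M.cells) : 0 < volume.real K.1 :=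
  ENNReal.toReal_pos ((isOpen_interior.measure_pos volume (M.interior_cell K)).trans_le
    (measure_mono interior_subset)).ne' (M.isCompact_cell K).measure_lt_top.ne

section Forms

variable {m : ℕ}

theorem aPw_comm (u v : M.CellSpace m) : M.aPw u v = M.aPw v u := by
  simp only [aPw, real_inner_comm]

theorem aPw_add_left (u₁ u₂ v : M.CellSpace m) :
    M.aPw (u₁ + u₂) v = M.aPw u₁ v + M.aPw u₂ v := by
  simp only [aPw, ← Finset.sum_add_distrib]
  refine Finset.sum_congr rfl fun K _ => ?_
  simp only [Pi.add_apply, Submodule.coe_add, polyGrad_add, inner_add_left]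
  exact integral_add
    (Continuous.continuousOn (by fun_prop) |>.integrableOn_compact (M.isCompact_cell K))
    (Continuous.continuousOn (by fun_prop) |>.integrableOn_compact (M.isCompact_cell K))

theorem aPw_smul_left (c : ℝ) (u v : M.CellSpace m) : M.aPw (c • u) v = c * M.aPw u v := by
  simp only [aPw, Finset.mul_sum]
  refine Finset.sum_congr rfl fun K _ => ?_
  simp only [Pi.smul_apply, SetLike.val_smul, polyGrad_smul, real_inner_smul_left]
  exact integral_const_mul _ _

theorem aPw_self_nonneg (u : M.CellSpace m) : 0 ≤ M.aPw u u :=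
  Finset.sum_nonneg fun _ _ => integral_nonneg fun _ => real_inner_self_nonneg

/-- A piecewise polynomial of vanishing energy is piecewise constant. -/
theorem eq_C_of_aPw_self_eq_zero {u : M.CellSpace m} (h : M.aPw u u = 0) (K : M.cells) :
    (u K).1 = MvPolynomial.C (MvPolynomial.coeff 0 (u K).1) := by
  have h1 := (Finset.sum_eq_zero_iff_of_nonneg
    fun K _ => integral_nonneg fun _ => real_inner_self_nonneg).1 h K (Finset.mem_univ K)
  refine eq_C_of_polyGrad_eq_zero isOpen_interior (M.interior_cell K) fun x hx => ?_
  exact inner_self_eq_zero.1 (eq_zero_of_setIntegral_eq_zero (M.isCompact_cell K) (by fun_prop)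
    (fun _ => real_inner_self_nonneg) h1 x hx)

/-- The bilinear form `a_pw`. -/
def aPwForm (m : ℕ) : LinearMap.BilinForm ℝ (M.CellSpace m) :=
  LinearMap.mk₂ ℝ M.aPw M.aPw_add_left M.aPw_smul_left
    (fun u v w => by rw [aPw_comm, aPw_add_left, aPw_comm, aPw_comm M w])
    (fun c u v => by rw [aPw_comm, aPw_smul_left, aPw_comm, smul_eq_mul])

/-- The integral over the cell `K`. -/
def cellIntegral (m : ℕ) (K : M.cells) : M.CellSpace m →ₗ[ℝ] ℝ where
  toFun u := ∫ x in K.1, polyEval (u K).1 x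
  map_add' u v := by
    simp only [Pi.add_apply, Submodule.coe_add, polyEval_add]
    exact integral_add
      ((continuous_polyEval _).continuousOn.integrableOn_compact (M.isCompact_cell K))
      ((continuous_polyEval _).continuousOn.integrableOn_compact (M.isCompact_cell K))
  map_smul' c u := by
    simp only [Pi.smul_apply, SetLike.val_smul, polyEval_smul]
    exact integral_const_mul _ _

theorem cellIntegral_apply (K : M.cells) (u : M.CellSpace m) :
    M.cellIntegral m K u = ∫ x in K.1, polyEval (u K).1 x := rfl

/-- The bilinear form `a_pw` plus the products of the integrals over the cells. -/
def meanForm (m : ℕ) : LinearMap.BilinForm ℝ (M.CellSpace m) :=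
  M.aPwForm m + ∑ K, (LinearMap.mul ℝ ℝ).compl₁₂ (M.cellIntegral m K) (M.cellIntegral m K)

theorem meanForm_apply (u v : M.CellSpace m) :
    M.meanForm m u v = M.aPw u v + ∑ K, M.cellIntegral m K u * M.cellIntegral m K v := by
  simp [meanForm, aPwForm]

theorem eq_zero_of_aPw_of_cellIntegral {u : M.CellSpace m} (ha : M.aPw u u = 0)
    (hi : ∀ K, M.cellIntegral m K u = 0) : u = 0 := by
  funext K
  have h1 := M.eq_C_of_aPw_self_eq_zero ha K
  have h2 := hi K
  rw [cellIntegral_apply, h1] at h2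
  simp only [polyEval_C, setIntegral_const, smul_eq_mul] at h2
  have h3 := (mul_eq_zero.1 h2).resolve_left (M.volume_cell_pos K).ne'
  refine Subtype.ext ?_
  rw [h1, h3]
  simp

theorem eq_zero_of_meanForm_self_eq_zero (u : M.CellSpace m) (h : M.meanForm m u u = 0) :
    u = 0 := by
  rw [meanForm_apply] at h
  have h1 := M.aPw_self_nonneg u
  have h2 : 0 ≤ ∑ K, M.cellIntegral m K u * M.cellIntegral m K u :=
    Finset.sum_nonneg fun _ _ => mul_self_nonneg _
  have h3 : ∑ K, M.cellIntegral m K u * M.cellIntegral m K u = 0 := by linarith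
  refine M.eq_zero_of_aPw_of_cellIntegral (by linarith) fun K => ?_
  exact mul_self_eq_zero.1 ((Finset.sum_eq_zero_iff_of_nonneg fun _ _ => mul_self_nonneg _).1 h3 K
    (Finset.mem_univ K))

/-- The piecewise polynomial that is `1` on the cell `K` and `0` on the others. -/
def cellOne (m : ℕ) (K : M.cells) : M.CellSpace m :=
  Pi.single K ⟨MvPolynomial.C 1, C_mem_Poly m 1⟩

theorem cellOne_eq_C (K K' : M.cells) :
    (M.cellOne m K K').1 = MvPolynomial.C (if K' = K then 1 else 0) := by
  unfold cellOne
  split_ifs with h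
  · subst h
    simp
  · simp [Pi.single_eq_of_ne h]

theorem normalJump_add (φ ψ : M.CellSpace m) (S : M.sides) (x : Space n) :
    M.normalJump (φ + ψ) S x = M.normalJump φ S x + M.normalJump ψ S x := by
  simp only [normalJump, Pi.add_apply, Submodule.coe_add, polyGrad_add, inner_add_left,
    Finset.sum_add_distrib]
  ring

theorem normalJump_smul (c : ℝ) (φ : M.CellSpace m) (S : M.sides) (x : Space n) :
    M.normalJump (c • φ) S x = c * M.normalJump φ S x := by
  simp only [normalJump, Pi.smul_apply, SetLike.val_smul, polyGrad_smul, real_inner_smul_left,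
    ← Finset.mul_sum]
  ring

@[fun_prop] theorem continuous_normalJump (φ : M.CellSpace m) (S : M.sides) :
    Continuous (M.normalJump φ S) := by
  unfold normalJump
  fun_prop

theorem continuous_normalJump_restrict (φ : M.CellSpace m) (S : M.sides) :
    Continuous fun x : S.1 => M.normalJump φ S x.1 :=
  (M.continuous_normalJump φ S).comp continuous_subtype_val

end Forms

variable {k : ℕ}

theorem continuous_sideValue (v : M.Vh k) (S : M.sides) : Continuous (v.2.1 S).1 :=
  continuous_of_mem_sidePoly (v.2.1 S).2

/-- The right-hand side of the definition of the potential reconstruction. -/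
def load (v : M.Vh k) (φ : M.CellSpace (k + 1)) : ℝ :=
  -(∑ K : M.cells, cellInner K.1 (polyEval (v.1 K).1) (polyEval (polyLaplacian (φ K).1))) +
    ∑ S : M.sides, sideInner (v.2.1 S).1 (fun x => M.normalJump φ S x.1)

theorem load_add_right (v : M.Vh k) (φ ψ : M.CellSpace (k + 1)) :
    M.load v (φ + ψ) = M.load v φ + M.load v ψ := by
  have h1 : ∀ K : M.cells,
      cellInner K.1 (polyEval (v.1 K).1) (polyEval (polyLaplacian ((φ + ψ) K).1)) =
      cellInner K.1 (polyEval (v.1 K).1) (polyEval (polyLaplacian (φ K).1)) +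
      cellInner K.1 (polyEval (v.1 K).1) (polyEval (polyLaplacian (ψ K).1)) := fun K => by
    simp only [cellInner_comm K.1 (polyEval (v.1 K).1)]
    rw [← cellInner_add_left (M.isCompact_cell K) (by fun_prop) (by fun_prop) (by fun_prop)]
    congr 1
    funext x
    simp
  have h2 : ∀ S : M.sides, sideInner (v.2.1 S).1 (fun x => M.normalJump (φ + ψ) S x.1) =
      sideInner (v.2.1 S).1 (fun x => M.normalJump φ S x.1) +
      sideInner (v.2.1 S).1 (fun x => M.normalJump ψ S x.1) := fun S => by
    rw [← (M.isSide S).sideInner_add_right (M.continuous_sideValue v S)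
      (M.continuous_normalJump_restrict φ S) (M.continuous_normalJump_restrict ψ S)]
    simp only [normalJump_add]
  simp only [load, h1, h2, Finset.sum_add_distrib]
  ring

theorem load_smul_right (c : ℝ) (v : M.Vh k) (φ : M.CellSpace (k + 1)) :
    M.load v (c • φ) = c * M.load v φ := by
  have h1 : ∀ K : M.cells,
      cellInner K.1 (polyEval (v.1 K).1) (polyEval (polyLaplacian ((c • φ) K).1)) =
      c * cellInner K.1 (polyEval (v.1 K).1) (polyEval (polyLaplacian (φ K).1)) := fun K => by
    simp only [cellInner_comm K.1 (polyEval (v.1 K).1)]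
    rw [← cellInner_smul_left]
    congr 1
    funext x
    simp
  have h2 : ∀ S : M.sides, sideInner (v.2.1 S).1 (fun x => M.normalJump (c • φ) S x.1) =
      c * sideInner (v.2.1 S).1 (fun x => M.normalJump φ S x.1) := fun S => by
    simp only [normalJump_smul]
    exact sideInner_smul_right _ _ _
  simp only [load, h1, h2, ← Finset.mul_sum]
  ring

theorem load_add_left (u v : M.Vh k) (φ : M.CellSpace (k + 1)) :
    M.load (u + v) φ = M.load u φ + M.load v φ := by
  have h1 : ∀ K : M.cells,
      cellInner K.1 (polyEval ((u + v).1 K).1) (polyEval (polyLaplacian (φ K).1)) =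
      cellInner K.1 (polyEval (u.1 K).1) (polyEval (polyLaplacian (φ K).1)) +
      cellInner K.1 (polyEval (v.1 K).1) (polyEval (polyLaplacian (φ K).1)) := fun K => by
    rw [← cellInner_add_left (M.isCompact_cell K) (by fun_prop) (by fun_prop) (by fun_prop)]
    congr 1
    funext x
    simp
  have h2 : ∀ S : M.sides, sideInner ((u + v).2.1 S).1 (fun x => M.normalJump φ S x.1) =
      sideInner (u.2.1 S).1 (fun x => M.normalJump φ S x.1) +
      sideInner (v.2.1 S).1 (fun x => M.normalJump φ S x.1) := fun S => by
    rw [← (M.isSide S).sideInner_add_left (M.continuous_sideValue u S)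
      (M.continuous_sideValue v S) (M.continuous_normalJump_restrict φ S)]
    rfl
  simp only [load, h1, h2, Finset.sum_add_distrib]
  ring

theorem load_smul_left (c : ℝ) (v : M.Vh k) (φ : M.CellSpace (k + 1)) :
    M.load (c • v) φ = c * M.load v φ := by
  have h1 : ∀ K : M.cells,
      cellInner K.1 (polyEval ((c • v).1 K).1) (polyEval (polyLaplacian (φ K).1)) =
      c * cellInner K.1 (polyEval (v.1 K).1) (polyEval (polyLaplacian (φ K).1)) := fun K => by
    rw [← cellInner_smul_left]
    congr 1
    funext x
    simp
  have h2 : ∀ S : M.sides, sideInner ((c • v).2.1 S).1 (fun x => M.normalJump φ S x.1) =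
      c * sideInner (v.2.1 S).1 (fun x => M.normalJump φ S x.1) := fun S =>
    sideInner_smul_left c (v.2.1 S).1 _
  simp only [load, h1, h2, ← Finset.mul_sum]
  ring

theorem isReconstruction_iff (v : M.Vh k) (r : M.CellSpace (k + 1)) :
    M.IsReconstruction v r ↔ (∀ φ, M.aPw r φ = M.load v φ) ∧
      ∀ K, M.cellIntegral (k + 1) K r = M.cellIntegral (k + 1) K v.1 := Iff.rfl

theorem aPw_cellOne (r : M.CellSpace (k + 1)) (K : M.cells) :
    M.aPw r (M.cellOne (k + 1) K) = 0 := by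
  simp only [aPw, cellOne_eq_C, polyGrad_C]
  simp

/-- This is the compatibility condition: the constants annihilated by `aPw` are also annihilated by
the load, as gradients and Laplacians of constants vanish. -/
theorem load_cellOne (v : M.Vh k) (K : M.cells) : M.load v (M.cellOne (k + 1) K) = 0 := by
  simp only [load, normalJump, cellOne_eq_C, cellInner, polyLaplacian_C, polyGrad_C, polyEval_zero]
  simp [sideInner]

theorem cellIntegral_cellOne (K K' : M.cells) :
    M.cellIntegral (k + 1) K' (M.cellOne (k + 1) K) = if K' = K then volume.real K'.1 else 0 := by
  simp only [cellIntegral_apply, cellOne_eq_C, polyEval_C]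
  simp

/-- The potential reconstruction exists and is unique. -/
theorem existsUnique_isReconstruction (v : M.Vh k) :
    ∃! r : M.CellSpace (k + 1), M.IsReconstruction v r := by
  -- The load is augmented by the same mean value terms as the form, now with the prescribed
  -- integrals of `v`.
  let F : Module.Dual ℝ (M.CellSpace (k + 1)) :=
    { toFun := fun φ => M.load v φ +
        ∑ K, M.cellIntegral (k + 1) K v.1 * M.cellIntegral (k + 1) K φ
      map_add' := fun φ ψ => by
        simp only [load_add_right, map_add, mul_add, Finset.sum_add_distrib]
        ring
      map_smul' := fun c φ => by
        simp only [load_smul_right, map_smul, smul_eq_mul, mul_left_comm _ c, ← Finset.mul_sum,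
          RingHom.id_apply, mul_add] }
  obtain ⟨r, hr⟩ := (bijective_of_posDef _ M.eq_zero_of_meanForm_self_eq_zero).2 F
  have hr' : ∀ φ, M.aPw r φ + ∑ K, M.cellIntegral (k + 1) K r * M.cellIntegral (k + 1) K φ =
      M.load v φ + ∑ K, M.cellIntegral (k + 1) K v.1 * M.cellIntegral (k + 1) K φ := fun φ => by
    rw [← meanForm_apply, hr]
    rfl
  have hmean : ∀ K, M.cellIntegral (k + 1) K r = M.cellIntegral (k + 1) K v.1 := fun K => by
    have := hr' (M.cellOne (k + 1) K)
    simp only [aPw_cellOne, load_cellOne, cellIntegral_cellOne, mul_ite, mul_zero,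
      Finset.sum_ite_eq', Finset.mem_univ, if_true, zero_add] at this
    exact mul_right_cancel₀ (M.volume_cell_pos K).ne' this
  refine ⟨r, (M.isReconstruction_iff v r).2 ⟨fun φ => ?_, hmean⟩, fun r' hr'' => ?_⟩
  · have := hr' φ
    simp only [hmean] at this
    linarith
  -- Every reconstruction solves the augmented equation, whose solution is unique.
  · replace hr'' := (M.isReconstruction_iff v r').1 hr''
    refine (bijective_of_posDef _ M.eq_zero_of_meanForm_self_eq_zero).1 ?_
    rw [hr]
    refine LinearMap.ext fun φ => ?_
    rw [meanForm_apply, hr''.1]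
    simp only [hr''.2]
    rfl

theorem isReconstruction_recon (v : M.Vh k) : M.IsReconstruction v (M.recon v) :=
  Classical.epsilon_spec (M.existsUnique_isReconstruction v).exists

/-- The choice behind `recon` is linear only because the reconstruction is unique. -/
theorem recon_add (u v : M.Vh k) : M.recon (u + v) = M.recon u + M.recon v := by
  refine (M.existsUnique_isReconstruction (u + v)).unique (M.isReconstruction_recon _) ?_
  have hu := (M.isReconstruction_iff u _).1 (M.isReconstruction_recon u)
  have hv := (M.isReconstruction_iff v _).1 (M.isReconstruction_recon v)
  refine (M.isReconstruction_iff _ _).2 ⟨fun φ => ?_, fun K => ?_⟩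
  · rw [aPw_add_left, load_add_left, hu.1, hv.1]
  · rw [map_add, Prod.fst_add, map_add, hu.2, hv.2]

theorem recon_smul (c : ℝ) (v : M.Vh k) : M.recon (c • v) = c • M.recon v := by
  refine (M.existsUnique_isReconstruction (c • v)).unique (M.isReconstruction_recon _) ?_
  have hv := (M.isReconstruction_iff v _).1 (M.isReconstruction_recon v)
  refine (M.isReconstruction_iff _ _).2 ⟨fun φ => ?_, fun K => ?_⟩
  · rw [aPw_smul_left, load_smul_left, hv.1]
  · rw [map_smul, Prod.smul_fst, map_smul, hv.2]

end PolytopalMesh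

/-! ### Stabilization, positive definiteness and the discrete eigenvalue problem -/

namespace PolytopalMesh

variable {n : ℕ} {Ω : Set (Space n)} (M : PolytopalMesh Ω) {k : ℕ}

@[fun_prop] theorem continuous_cellDefect (v : M.Vh k) (K : M.cells) :
    Continuous (M.cellDefect v K) := by
  unfold cellDefect
  fun_prop

theorem continuous_sideDefect (v : M.Vh k) (K : M.cells) (S : M.sides) :
    Continuous (M.sideDefect v K S) :=
  (M.continuous_sideValue v S).sub ((continuous_polyEval _).comp continuous_subtype_val)

theorem cellDefect_add (u v : M.Vh k) (K : M.cells) :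
    M.cellDefect (u + v) K = fun x => M.cellDefect u K x + M.cellDefect v K x := by
  funext x
  simp only [cellDefect, recon_add, Prod.fst_add, Pi.add_apply, Submodule.coe_add, polyEval_add]
  ring

theorem cellDefect_smul (c : ℝ) (v : M.Vh k) (K : M.cells) :
    M.cellDefect (c • v) K = fun x => c * M.cellDefect v K x := by
  funext x
  simp only [cellDefect, recon_smul, Prod.smul_fst, Pi.smul_apply, SetLike.val_smul, polyEval_smul]
  ring

theorem sideDefect_add (u v : M.Vh k) (K : M.cells) (S : M.sides) :
    M.sideDefect (u + v) K S = fun x => M.sideDefect u K S x + M.sideDefect v K S x := by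
  funext x
  simp only [sideDefect, recon_add, Prod.snd_add, Pi.add_apply, Submodule.coe_add, polyEval_add]
  ring

theorem sideDefect_smul (c : ℝ) (v : M.Vh k) (K : M.cells) (S : M.sides) :
    M.sideDefect (c • v) K S = fun x => c * M.sideDefect v K S x := by
  funext x
  simp only [sideDefect, recon_smul, Prod.smul_snd, Pi.smul_apply, SetLike.val_smul, polyEval_smul,
    smul_eq_mul]
  ring

/-- The projection acts on the first argument only, but it is self-adjoint. Linearity in the first
argument thus follows from linearity in the second. -/
theorem stab_comm (σ : ℝ) (u v : M.Vh k) : M.stab σ u v = M.stab σ v u := by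
  refine Finset.sum_congr rfl fun K _ => ?_
  simp only [stabCell]
  rw [cellInner_comm]
  congr 2
  refine Finset.sum_congr rfl fun S _ => ?_
  rw [(M.isSide S).sideInner_sideProj_comm k (M.continuous_sideDefect u K S)
    (M.continuous_sideDefect v K S)]

theorem continuous_sideProj (v : M.Vh k) (K : M.cells) (S : M.sides) :
    Continuous (sideProj k (M.sideDefect v K S)) :=
  continuous_of_mem_sidePoly ((M.isSide S).sideProj_mem k (M.continuous_sideDefect v K S))

theorem stab_add_right (σ : ℝ) (u v w : M.Vh k) :
    M.stab σ u (v + w) = M.stab σ u v + M.stab σ u w := by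
  simp only [stab, ← Finset.sum_add_distrib]
  refine Finset.sum_congr rfl fun K _ => ?_
  have h1 : cellInner K.1 (M.cellDefect u K) (M.cellDefect (v + w) K) =
      cellInner K.1 (M.cellDefect u K) (M.cellDefect v K) +
      cellInner K.1 (M.cellDefect u K) (M.cellDefect w K) := by
    rw [cellDefect_add]
    simp only [cellInner_comm K.1 (M.cellDefect u K)]
    exact cellInner_add_left (M.isCompact_cell K) (by fun_prop) (by fun_prop) (by fun_prop)
  have h2 : ∀ S : M.sides, sideInner (sideProj k (M.sideDefect u K S)) (M.sideDefect (v + w) K S) =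
      sideInner (sideProj k (M.sideDefect u K S)) (M.sideDefect v K S) +
      sideInner (sideProj k (M.sideDefect u K S)) (M.sideDefect w K S) := fun S => by
    rw [sideDefect_add]
    exact (M.isSide S).sideInner_add_right (M.continuous_sideProj u K S)
      (M.continuous_sideDefect v K S) (M.continuous_sideDefect w K S)
  simp only [stabCell, h1, h2, mul_add, Finset.sum_add_distrib]
  ring

theorem stab_smul_right (σ c : ℝ) (u v : M.Vh k) :
    M.stab σ u (c • v) = c * M.stab σ u v := by
  simp only [stab, Finset.mul_sum]
  refine Finset.sum_congr rfl fun K _ => ?_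
  have h1 : cellInner K.1 (M.cellDefect u K) (M.cellDefect (c • v) K) =
      c * cellInner K.1 (M.cellDefect u K) (M.cellDefect v K) := by
    rw [cellDefect_smul]
    simp only [cellInner_comm K.1 (M.cellDefect u K)]
    exact cellInner_smul_left _ _ _ _
  have h2 : ∀ S : M.sides, sideInner (sideProj k (M.sideDefect u K S)) (M.sideDefect (c • v) K S) =
      c * sideInner (sideProj k (M.sideDefect u K S)) (M.sideDefect v K S) := fun S => by
    rw [sideDefect_smul]
    exact sideInner_smul_right _ _ _
  simp only [stabCell, h1, h2, mul_left_comm _ c, ← Finset.mul_sum]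
  ring

/-- The bilinear form `a_h + s_h`. -/
def energyForm (σ : ℝ) (k : ℕ) : LinearMap.BilinForm ℝ (M.Vh k) :=
  LinearMap.mk₂ ℝ (fun u v => M.aForm u v + M.stab σ u v)
    (fun u v w => by
      simp only [aForm, recon_add, aPw_add_left, M.stab_comm σ _ w, stab_add_right]
      ring)
    (fun c u v => by
      simp only [aForm, recon_smul, aPw_smul_left, M.stab_comm σ _ v, stab_smul_right, smul_eq_mul]
      ring)
    (fun u v w => by
      simp only [aForm, recon_add, M.aPw_comm (M.recon u), aPw_add_left, stab_add_right]
      ring)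
    (fun c u v => by
      simp only [aForm, recon_smul, M.aPw_comm (M.recon u), aPw_smul_left, stab_smul_right,
        smul_eq_mul]
      ring)

theorem energyForm_apply (σ : ℝ) (u v : M.Vh k) :
    M.energyForm σ k u v = M.aForm u v + M.stab σ u v := rfl

theorem energyForm_isSymm (σ : ℝ) : (M.energyForm σ k).IsSymm := ⟨fun u v => by
  simp only [energyForm_apply, aForm]
  rw [aPw_comm, stab_comm]⟩

/-- The bilinear form `b_h`. -/
def massForm (k : ℕ) : LinearMap.BilinForm ℝ (M.Vh k) :=
  have hcomm : ∀ u v : M.Vh k, M.bForm u v = M.bForm v u := fun u v =>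
    Finset.sum_congr rfl fun K _ => cellInner_comm _ _ _
  have hadd : ∀ u v w : M.Vh k, M.bForm (u + v) w = M.bForm u w + M.bForm v w := fun u v w => by
    simp only [bForm, ← Finset.sum_add_distrib]
    refine Finset.sum_congr rfl fun K _ => ?_
    rw [← cellInner_add_left (M.isCompact_cell K) (by fun_prop) (by fun_prop) (by fun_prop)]
    congr 1
    funext x
    simp
  have hsmul : ∀ (c : ℝ) (u w : M.Vh k), M.bForm (c • u) w = c * M.bForm u w := fun c u w => by
    simp only [bForm, Finset.mul_sum]
    refine Finset.sum_congr rfl fun K _ => ?_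
    rw [← cellInner_smul_left]
    congr 1
    funext x
    simp
  LinearMap.mk₂ ℝ M.bForm hadd hsmul
    (fun u v w => by rw [hcomm, hadd, hcomm u, hcomm u])
    (fun c u v => by rw [hcomm, hsmul, hcomm u, smul_eq_mul])

theorem massForm_apply (u v : M.Vh k) : M.massForm k u v = M.bForm u v := rfl

theorem massForm_isSymm : (M.massForm k).IsSymm := ⟨fun u v => by
  simp only [massForm_apply]
  exact Finset.sum_congr rfl fun K _ => cellInner_comm _ _ _⟩

theorem bForm_self_nonneg (v : M.Vh k) : 0 ≤ M.bForm v v :=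
  Finset.sum_nonneg fun _ _ => cellInner_self_nonneg _ _

/-- The form `b_h` sees only the cell part and is definite there, since a polynomial is determined
by its values inside a cell. -/
theorem ker_massForm : LinearMap.ker (M.massForm k) =
    LinearMap.ker (LinearMap.fst ℝ (M.CellSpace (k + 1)) (M.sideSpace k)) := by
  ext v
  simp only [LinearMap.mem_ker, LinearMap.fst_apply]
  constructor
  · intro h
    have h1 : M.bForm v v = 0 := by rw [← massForm_apply, h]; rfl
    funext K
    exact Subtype.ext (eq_zero_of_cellInner_self_eq_zero (M.isCompact_cell K) (M.interior_cell K)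
      ((Finset.sum_eq_zero_iff_of_nonneg fun _ _ => cellInner_self_nonneg _ _).1 h1 K
        (Finset.mem_univ K)))
  · intro h
    refine LinearMap.ext fun w => ?_
    simp [massForm_apply, bForm, h, cellInner]

theorem finrank_range_massForm : Module.finrank ℝ (LinearMap.range (M.massForm k)) =
    Module.finrank ℝ (M.CellSpace (k + 1)) := by
  have h1 := LinearMap.finrank_range_add_finrank_ker (V := M.Vh k) (M.massForm k)
  have h2 := LinearMap.finrank_range_add_finrank_ker (V := M.Vh k) (V₂ := M.CellSpace (k + 1))
    (LinearMap.fst ℝ (M.CellSpace (k + 1)) (M.sideSpace k))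
  rw [LinearMap.range_eq_top.2 LinearMap.fst_surjective, finrank_top] at h2
  rw [ker_massForm] at h1
  omega

theorem exists_cell_of_side (hΩ : IsLipschitzDomain Ω) (S : M.sides) :
    ∃ K : M.cells, S.1 ⊆ frontier K.1 := by
  rcases (M.isSide S).interior_or_boundary with ⟨K₁, h₁, K₂, h₂, hne, hsub⟩ | ⟨K, hK, hsub⟩
  · exact ⟨⟨K₁, h₁⟩, M.subset_frontier_of_ne h₁ h₂ hne (fun y hy => (hsub hy).1)
      fun y hy => (hsub hy).2⟩
  · exact ⟨⟨K, hK⟩, M.subset_frontier_of_boundary hΩ hK hsub⟩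

theorem sideProj_term_nonneg (v : M.Vh k) (K : M.cells) (S : M.sides) :
    0 ≤ sideInner (sideProj k (M.sideDefect v K S)) (M.sideDefect v K S) := by
  rw [(M.isSide S).sideInner_sideProj_self k (M.continuous_sideDefect v K S)]
  exact sideInner_self_nonneg _

theorem weight_nonneg (S K : Set (Space n)) : 0 ≤ weight S K := by
  unfold weight
  positivity

theorem stabCell_self_nonneg {σ : ℝ} (hσ : 0 < σ) (K : M.cells) (v : M.Vh k) :
    0 ≤ M.stabCell σ K v v := by
  have h1 := cellInner_self_nonneg K.1 (M.cellDefect v K)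
  have h2 : 0 ≤ ∑ S : M.sides with S.1 ⊆ frontier K.1, (weight S.1 K.1)⁻¹ *
      sideInner (sideProj k (M.sideDefect v K S)) (M.sideDefect v K S) :=
    Finset.sum_nonneg fun S _ => mul_nonneg (inv_nonneg.2 (weight_nonneg _ _))
      (M.sideProj_term_nonneg v K S)
  unfold stabCell
  positivity

theorem diam_cell_pos (hn : 0 < n) (K : M.cells) : 0 < Metric.diam K.1 :=
  diam_pos_of_interior_nonempty hn (M.isCompact_cell K) (M.interior_cell K)

/-- If the stabilization vanishes, then so do the defects in the cells and the projections of the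
defects on the sides. -/
theorem defects_eq_zero_of_stabCell_self_eq_zero (hn : 0 < n) {σ : ℝ} (hσ : 0 < σ) {K : M.cells}
    {v : M.Vh k} (h : M.stabCell σ K v v = 0) :
    v.1 K = M.recon v K ∧
      ∀ S : M.sides, S.1 ⊆ frontier K.1 → sideProj k (M.sideDefect v K S) = 0 := by
  have h1 := cellInner_self_nonneg K.1 (M.cellDefect v K)
  have hnn : ∀ S ∈ (Finset.univ.filter fun S : M.sides => S.1 ⊆ frontier K.1),
      0 ≤ (weight S.1 K.1)⁻¹ *
        sideInner (sideProj k (M.sideDefect v K S)) (M.sideDefect v K S) := fun S _ =>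
    mul_nonneg (inv_nonneg.2 (weight_nonneg _ _)) (M.sideProj_term_nonneg v K S)
  have h2 := Finset.sum_nonneg hnn
  have hd := M.diam_cell_pos hn K
  have hc : 0 < σ * (Metric.diam K.1 ^ 2)⁻¹ := by positivity
  unfold stabCell at h
  obtain ⟨e1, e2⟩ := (add_eq_zero_iff_of_nonneg (mul_nonneg hc.le h1) (mul_nonneg hσ.le h2)).1 h
  constructor
  · have h3 := (mul_eq_zero.1 e1).resolve_left hc.ne'
    have h4 : cellInner K.1 (polyEval ((v.1 K).1 - (M.recon v K).1))
        (polyEval ((v.1 K).1 - (M.recon v K).1)) = 0 := by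
      rw [← h3]
      congr 1 <;> · funext x; simp [cellDefect]
    exact Subtype.ext (sub_eq_zero.1 (eq_zero_of_cellInner_self_eq_zero (M.isCompact_cell K)
      (M.interior_cell K) h4))
  · intro S hS
    have h3 := (mul_eq_zero.1 e2).resolve_left hσ.ne'
    have h4 := (Finset.sum_eq_zero_iff_of_nonneg hnn).1 h3 S (by simp [hS])
    have hw := (M.isSide S).weight_pos hn (M.cell_polytope K.1 K.2) (M.interior_cell K) hS
    have h5 := (mul_eq_zero.1 h4).resolve_left (inv_pos.2 hw).ne'
    rw [(M.isSide S).sideInner_sideProj_self k (M.continuous_sideDefect v K S)] at h5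
    exact (M.isSide S).eq_zero_of_sideInner_self_eq_zero
      ((M.isSide S).sideProj_mem k (M.continuous_sideDefect v K S)) h5

/-- The form `a_h + s_h` is positive definite. -/
theorem energyForm_pos (hn : 0 < n) (hΩ : IsLipschitzDomain Ω) {σ : ℝ} (hσ : 0 < σ) {v : M.Vh k}
    (hv : v ≠ 0) : 0 < M.energyForm σ k v v := by
  have ha : 0 ≤ M.aForm v v := M.aPw_self_nonneg _
  have hs : 0 ≤ M.stab σ v v := Finset.sum_nonneg fun K _ => M.stabCell_self_nonneg hσ K v
  rw [energyForm_apply]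
  refine lt_of_le_of_ne (add_nonneg ha hs) fun h0 => hv ?_
  have ha0 : M.aPw (M.recon v) (M.recon v) = 0 := by
    change M.aForm v v = 0
    linarith
  have hs0 : M.stab σ v v = 0 := by linarith
  have hcell := fun K => M.defects_eq_zero_of_stabCell_self_eq_zero hn hσ
    ((Finset.sum_eq_zero_iff_of_nonneg fun K _ => M.stabCell_self_nonneg hσ K v).1 hs0 K
      (Finset.mem_univ K))
  have hconst := M.eq_C_of_aPw_self_eq_zero ha0
  -- The value `0` off the mesh is a default that never enters.
  let c : Set (Space n) → ℝ := fun K =>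
    if h : K ∈ M.cells then MvPolynomial.coeff 0 (M.recon v ⟨K, h⟩).1 else 0
  have hc : ∀ K : M.cells, (M.recon v K).1 = MvPolynomial.C (c K.1) := fun K => by
    rw [hconst K]
    simp [c]
  have hside : ∀ (K : M.cells) (S : M.sides), S.1 ⊆ frontier K.1 → ∀ x : S.1,
      (v.2.1 S).1 x = c K.1 := by
    intro K S hS x
    -- This relies on the reconstruction being constant: in general its trace has degree `k + 1`,
    -- and the projection would lose information.
    have hmem : M.sideDefect v K S ∈ sidePoly k S.1 := by
      have h1 : M.sideDefect v K S =
          (v.2.1 S).1 - polyRestrict S.1 (MvPolynomial.C (c K.1)) := by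
        funext x
        simp [sideDefect, hc K, polyRestrict]
      rw [h1]
      exact Submodule.sub_mem _ (v.2.1 S).2 ⟨_, C_mem_Poly k _, rfl⟩
    have h0 := congrFun ((M.isSide S).eq_zero_of_sideProj_eq_zero hmem ((hcell K).2 S hS)) x
    simp only [sideDefect, hc K, polyEval_C, Pi.zero_apply] at h0
    linarith
  have hc0 := M.eq_zero_of_no_jumps hn hΩ c
    (fun S hS K₁ h₁ K₂ h₂ hne hsub => by
      obtain ⟨x, hx⟩ := (M.side_isSide S hS).connected.nonempty
      rw [← hside ⟨K₁, h₁⟩ ⟨S, hS⟩ (M.subset_frontier_of_ne h₁ h₂ hne (fun y hy => (hsub hy).1)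
        fun y hy => (hsub hy).2) ⟨x, hx⟩,
        ← hside ⟨K₂, h₂⟩ ⟨S, hS⟩ (M.subset_frontier_of_ne h₂ h₁ hne.symm
        (fun y hy => (hsub hy).2) fun y hy => (hsub hy).1) ⟨x, hx⟩])
    (fun S hS K hK hsub => by
      obtain ⟨x, hx⟩ := (M.side_isSide S hS).connected.nonempty
      rw [← hside ⟨K, hK⟩ ⟨S, hS⟩ (M.subset_frontier_of_boundary hΩ hK hsub) ⟨x, hx⟩,
        v.2.2 ⟨S, hS⟩ ⟨K, hK, hsub⟩]
      rfl)
  refine Prod.ext ?_ (Subtype.ext ?_)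
  · funext K
    rw [(hcell K).1]
    exact Subtype.ext (by rw [hc K, hc0 K.1 K.2]; simp)
  · funext S
    refine Subtype.ext (funext fun x => ?_)
    -- Every side lies in the boundary of some cell, so the vanishing cell constants control all
    -- side values.
    obtain ⟨K, hK⟩ := M.exists_cell_of_side hΩ S
    rw [hside K S hK x, hc0 K.1 K.2]
    rfl

theorem coe_genEigenspace (σ : ℝ) (k : ℕ) (lam : ℝ) :
    (genEigenspace (V := M.Vh k) (M.energyForm σ k) (M.massForm k) lam : Set (M.Vh k)) =
      M.eigenvectors σ k lam := by
  ext u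
  rw [SetLike.mem_coe, mem_genEigenspace]
  rfl

theorem multiplicity_eq_finrank (σ : ℝ) (k : ℕ) (lam : ℝ) : M.multiplicity σ k lam =
    Module.finrank ℝ (genEigenspace (V := M.Vh k) (M.energyForm σ k) (M.massForm k) lam) := by
  rw [multiplicity, ← coe_genEigenspace, Set.finrank, Submodule.span_eq]

theorem isEigenvalue_iff (σ : ℝ) (k : ℕ) (lam : ℝ) : M.IsEigenvalue σ k lam ↔
    genEigenspace (V := M.Vh k) (M.energyForm σ k) (M.massForm k) lam ≠ ⊥ := by
  rw [Submodule.ne_bot_iff, IsEigenvalue, ← coe_genEigenspace]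
  rfl

theorem rayleighRitz_lt_top_iff_le (hn : 0 < n) (hΩ : IsLipschitzDomain Ω) {σ : ℝ} (hσ : 0 < σ)
    (j : ℕ) : M.rayleighRitz σ k j < ⊤ ↔ j ≤ Module.finrank ℝ (M.CellSpace (k + 1)) := by
  have h := rayleighRitz_lt_top_iff (V := M.Vh k) (M.energyForm σ k) (M.massForm k)
    (M.energyForm_isSymm σ) (fun v hv => M.energyForm_pos hn hΩ hσ hv) M.massForm_isSymm
    (fun v => by rw [massForm_apply]; exact M.bForm_self_nonneg v) j
  rw [finrank_range_massForm] at h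
  simp only [energyForm_apply, massForm_apply] at h
  exact h

end PolytopalMesh

end HHO

end

theorem lemma2p1 {n : ℕ} (hn : n = 2 ∨ n = 3) {Ω : Set (HHO.Space n)}
    (hΩ : HHO.IsLipschitzDomain Ω) (M : HHO.PolytopalMesh Ω) (k : ℕ) (σ : ℝ) (hσ : 0 < σ) :
    -- the potential reconstruction is well defined
    (∀ v : M.Vh k, ∃! r : M.CellSpace (k + 1), M.IsReconstruction v r) ∧
    -- `a_h + s_h` is a scalar product on `V_h`
    (∃ B : LinearMap.BilinForm ℝ (M.Vh k),
      (∀ u v : M.Vh k, B u v = M.aForm u v + M.stab σ u v) ∧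
      B.IsSymm ∧ ∀ v : M.Vh k, v ≠ 0 → 0 < B v v) ∧
    -- there are exactly `dim P_{k+1}(𝓜)` finite eigenvalues, counted with multiplicity
    {lam : ℝ | M.IsEigenvalue σ k lam}.Finite ∧
    ∑ᶠ lam : ℝ, M.multiplicity σ k lam = Module.finrank ℝ (M.CellSpace (k + 1)) ∧
    -- the same count for the Rayleigh-Ritz values `λ_h(1), …, λ_h(N)`, with `N = dim V_h`
    {j ∈ Finset.Icc 1 (Module.finrank ℝ (M.Vh k)) | M.rayleighRitz σ k j < ⊤}.card =
      Module.finrank ℝ (M.CellSpace (k + 1)) := by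
  have hn0 : 0 < n := by omega
  have hpos : ∀ v : M.Vh k, v ≠ 0 → 0 < M.energyForm σ k v v := fun v hv =>
    M.energyForm_pos hn0 hΩ hσ hv
  have hsum := HHO.sum_finrank_genEigenspace (V := M.Vh k) (M.energyForm σ k) (M.massForm k)
    (M.energyForm_isSymm σ) hpos M.massForm_isSymm
  refine ⟨M.existsUnique_isReconstruction, ⟨M.energyForm σ k, fun _ _ => rfl,
    M.energyForm_isSymm σ, hpos⟩, ?_, ?_, ?_⟩
  · simpa only [M.isEigenvalue_iff] using hsum.1
  · simp only [M.multiplicity_eq_finrank]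
    rw [hsum.2, M.finrank_range_massForm]
  · have hRR := M.rayleighRitz_lt_top_iff_le hn0 hΩ (k := k) hσ
    -- This keeps the threshold for finiteness within the index range up to `dim V_h`.
    have hle : Module.finrank ℝ (M.CellSpace (k + 1)) ≤ Module.finrank ℝ (M.Vh k) := by
      rw [← M.finrank_range_massForm]
      exact LinearMap.finrank_range_le (M := M.Vh k) (M.massForm k)
    have hset : {j ∈ Finset.Icc 1 (Module.finrank ℝ (M.Vh k)) | M.rayleighRitz σ k j < ⊤} =
        Finset.Icc 1 (Module.finrank ℝ (M.CellSpace (k + 1))) := by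
      ext j
      simp only [Finset.mem_filter, Finset.mem_Icc, hRR]
      omega
    rw [hset, Nat.card_Icc, Nat.add_sub_cancel]
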